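/- Conventions. For a complex torus $A=\mathbb{C}^k/\Gamma$, a (ramified) Galois covering $\sigma:A\to\mathbb{P}^k$ with group $G$ is a surjective holomorphic map whose fibres are exactly the orbits of a finite group $G$ of holomorphic automorphisms of $A$ (that is, $\sigma$ is the quotient map by $G$). A Lattès example is a holomorphic endomorphism $f$ of $\mathbb{P}^k$ of degree $d\ge 2$ for which there are a $k$-dimensional complex torus $A$, a Galois covering $\sigma:A\to\mathbb{P}^k$ with some group $G$ and a holomorphic endomorphism $D$ of $A$ with $\sigma\circ D=f\circ\sigma$. A holomorphic endomorphism $f$ of $\mathbb{P}^k$ with critical set $\mathcal{C}_f$ is critically finite if $\bigcup_{n\ge 1}f^n(\mathcal{C}_f)$ is an algebraic subset of $\mathbb{P}^k$. **Proposition.** The following endomorphisms of $\mathbb{P}^2$ are critically finite and are Lattès examples: $$f_1[x:y:z]=[(-x+y+z)^2:(x-y+z)^2:(x+y-z)^2],$$ $$f_2[x:y:z]=[(x-y+z)^2:(-x+y+z)^2:(x+y-z)^2],$$ $$f_3[x:y:z]=[(x+y-z)^2:(-x+y+z)^2:(x-y+z)^2].$$ More precisely, let $A_i=\mathbb{C}/(\mathbb{Z}+i\mathbb{Z})$.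 Let $G(4,2,2)$ be the group generated by the matrices $$\begin{pmatrix}0&1\\1&0\end{pmatrix},\quad \begin{pmatrix}0&e^{2i\pi/4}\\e^{-2i\pi/4}&0\end{pmatrix},\quad \begin{pmatrix}e^{4i\pi/4}&0\\0&1\end{pmatrix},$$ and let $G=\langle G(4,2,2),\tfrac{1+i}{2}\binom{1}{1}\rangle$ be the group of automorphisms of $A_i\times A_i$ generated by those induced by $G(4,2,2)$ and by the translation of vector $\tfrac{1+i}{2}\binom{1}{1}$. Then there is a Galois covering $\sigma:A_i\times A_i\to\mathbb{P}^2$ with group $G$ such that $$\sigma\circ D_j=f_j\circ\sigma\qquad (j=1,2,3)$$ for the endomorphisms of $A_i\times A_i$ induced by the matrices $$D_1=\sqrt2\begin{pmatrix}e^{i\pi/4}&0\\0&e^{i\pi/4}\end{pmatrix},\quad D_2=\sqrt2\begin{pmatrix}\tfrac1{\sqrt2}&\tfrac1{\sqrt2}\\\tfrac1{\sqrt2}&\tfrac{-1}{\sqrt2}\end{pmatrix},\quad D_3=\sqrt2\begin{pmatrix}\tfrac1{\sqrt2}&\tfrac1{\sqrt2}\\\tfrac{i}{\sqrt2}&\tfrac{-i}{\sqrt2}\end{pmatrix}.$$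 -/

import Mathlib

open scoped LinearAlgebra.Projectivization Topology Matrix

noncomputable section

namespace Lattes

/-- Complex projective space of dimension `k`, the space of lines of `ℂ^(k+1)`. -/
abbrev ProjSpace (k : ℕ) : Type := ℙ ℂ (Fin (k + 1) → ℂ)

/-- A lattice of `ℂ^k`: a discrete subgroup that spans `ℂ^k` over `ℝ`. -/
def IsLattice {k : ℕ} (Γ : Submodule ℤ (Fin k → ℂ)) : Prop :=
  DiscreteTopology Γ ∧ Submodule.span ℝ (Γ : Set (Fin k → ℂ)) = ⊤

/-- The complex torus `ℂ^k / Γ` (for a lattice `Γ`). -/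
abbrev Torus {k : ℕ} (Γ : Submodule ℤ (Fin k → ℂ)) : Type := (Fin k → ℂ) ⧸ Γ

/-- The canonical projection `ℂ^k → ℂ^k / Γ`. -/
abbrev toTorus {k : ℕ} (Γ : Submodule ℤ (Fin k → ℂ)) (v : Fin k → ℂ) : Torus Γ :=
  Submodule.Quotient.mk v

/-- A self-map of the torus is holomorphic if near every point it lifts to a holomorphic map
of `ℂ^k` (the projection `ℂ^k → ℂ^k / Γ` being a local biholomorphism). -/
def IsHolomorphicTorusMap {k : ℕ} (Γ : Submodule ℤ (Fin k → ℂ)) (φ : Torus Γ → Torus Γ) : Prop :=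
  ∀ v : Fin k → ℂ, ∃ L : (Fin k → ℂ) → (Fin k → ℂ),
    ∀ᶠ w in 𝓝 v, DifferentiableAt ℂ L w ∧ φ (toTorus Γ w) = toTorus Γ (L w)

/-- A map from the torus to projective space is holomorphic if near every point it can be written
`[L₀ : ⋯ : L_k]` in homogeneous coordinates that are holomorphic without common zero. -/
def IsHolomorphicToProj {k : ℕ} (Γ : Submodule ℤ (Fin k → ℂ)) (σ : Torus Γ → ProjSpace k) : Prop :=
  ∀ v : Fin k → ℂ, ∃ L : (Fin k → ℂ) → (Fin (k + 1) → ℂ),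
    ∀ᶠ w in 𝓝 v, DifferentiableAt ℂ L w ∧
      ∃ hL : L w ≠ 0, σ (toTorus Γ w) = Projectivization.mk ℂ (L w) hL

/-- `f` is a holomorphic endomorphism of degree `d` of projective space: it is induced by `k + 1`
homogeneous polynomials of degree `d` whose only common zero is the origin. -/
def IsEndomorphismOfDegree {k : ℕ} (d : ℕ) (f : ProjSpace k → ProjSpace k) : Prop :=
  ∃ F : Fin (k + 1) → MvPolynomial (Fin (k + 1)) ℂ,
    (∀ j, (F j).IsHomogeneous d) ∧
    ∀ (v : Fin (k + 1) → ℂ) (hv : v ≠ 0),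
      ∃ hF : (fun j => MvPolynomial.eval v (F j)) ≠ 0,
        f (Projectivization.mk ℂ v hv) = Projectivization.mk ℂ _ hF

/-- `σ : ℂ^k / Γ → ℙ^k` is a (ramified) Galois covering with group `G`: `G` is a finite group of
holomorphic automorphisms of the torus, and `σ` is a holomorphic surjection whose fibres are
exactly the orbits of `G`, i.e. `σ` is the quotient map by `G`. (As `ℙ^k` is normal, the
bijection `(ℂ^k / Γ) / G → ℙ^k` is then automatically biholomorphic.) -/
structure IsGaloisCovering {k : ℕ} (Γ : Submodule ℤ (Fin k → ℂ)) (σ : Torus Γ → ProjSpace k)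
    (G : Subgroup (Equiv.Perm (Torus Γ))) : Prop where
  finite : Finite G
  holomorphic_aut : ∀ g ∈ G, IsHolomorphicTorusMap Γ g
  holomorphic : IsHolomorphicToProj Γ σ
  surjective : Function.Surjective σ
  fibre : ∀ a b : Torus Γ, σ a = σ b ↔ ∃ g ∈ G, g a = b

/-- Lattès examples: holomorphic endomorphisms `f` of `ℙ^k` of degree `d ≥ 2` such that
`σ ∘ D = f ∘ σ` for some Galois covering `σ` of `ℙ^k` by a `k`-dimensional complex torus and some
holomorphic endomorphism `D` of that torus. -/
def IsLattesExample {k : ℕ} (f : ProjSpace k → ProjSpace k) : Prop :=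
  (∃ d : ℕ, 2 ≤ d ∧ IsEndomorphismOfDegree d f) ∧
  ∃ Γ : Submodule ℤ (Fin k → ℂ), IsLattice Γ ∧
    ∃ (G : Subgroup (Equiv.Perm (Torus Γ))) (σ : Torus Γ → ProjSpace k) (D : Torus Γ → Torus Γ),
      IsGaloisCovering Γ σ G ∧ IsHolomorphicTorusMap Γ D ∧ Function.Semiconj σ D f

/-- `L` is a holomorphic lift of `f : ℙ^k → ℙ^k` to `ℂ^(k+1) ∖ {0}` near `v`. -/
def IsLocalLift {k : ℕ} (f : ProjSpace k → ProjSpace k)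
    (L : (Fin (k + 1) → ℂ) → (Fin (k + 1) → ℂ)) (v : Fin (k + 1) → ℂ) : Prop :=
  ∀ᶠ w in 𝓝 v, DifferentiableAt ℂ L w ∧
    ∃ (hw : w ≠ 0) (hL : L w ≠ 0),
      f (Projectivization.mk ℂ w hw) = Projectivization.mk ℂ (L w) hL

/-- The critical set of `f`: the points `[v]` at which the differential of `f` is not injective.
The tangent space of `ℙ^k` at `[v]` is `ℂ^(k+1) / ℂ v`, and in terms of a local lift `L` the
differential of `f` is the map `ℂ^(k+1) / ℂ v → ℂ^(k+1) / ℂ L(v)` induced by that of `L`; its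
kernel does not depend on the lift. -/
def criticalSet {k : ℕ} (f : ProjSpace k → ProjSpace k) : Set (ProjSpace k) :=
  {p | ∃ (v : Fin (k + 1) → ℂ) (hv : v ≠ 0), Projectivization.mk ℂ v hv = p ∧
    ∃ L : (Fin (k + 1) → ℂ) → (Fin (k + 1) → ℂ), IsLocalLift f L v ∧
      ∃ w : Fin (k + 1) → ℂ, w ∉ Submodule.span ℂ {v} ∧
        fderiv ℂ L v w ∈ Submodule.span ℂ {L v}}

/-- Algebraic subsets of `ℙ^k`: zero sets of families of homogeneous polynomials. -/
def IsAlgebraicSet {k : ℕ} (S : Set (ProjSpace k)) : Prop :=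
  ∃ I : Set (MvPolynomial (Fin (k + 1)) ℂ), (∀ p ∈ I, ∃ n : ℕ, p.IsHomogeneous n) ∧
    ∀ (v : Fin (k + 1) → ℂ) (hv : v ≠ 0),
      Projectivization.mk ℂ v hv ∈ S ↔ ∀ p ∈ I, MvPolynomial.eval v p = 0

/-- `f` is critically finite: the forward orbit `⋃_{n ≥ 1} f^n(C_f)` of its critical set `C_f`
is algebraic. -/
def IsCriticallyFinite {k : ℕ} (f : ProjSpace k → ProjSpace k) : Prop :=
  IsAlgebraicSet (⋃ n ∈ Set.Ici 1, f^[n] '' criticalSet f)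

/-- The self-map of `ℙ^2` induced by a homogeneous quadratic map of `ℂ^3` without nontrivial
zero. -/
def quadraticMap (F : (Fin 3 → ℂ) → (Fin 3 → ℂ)) (h0 : ∀ v, F v = 0 → v = 0)
    (hF : ∀ (t : ℂ) (v : Fin 3 → ℂ), F (t • v) = t ^ 2 • F v) : ProjSpace 2 → ProjSpace 2 :=
  Projectivization.lift
    (fun v => Projectivization.mk ℂ (F v.1) (fun h => v.2 (h0 _ h)))
    (by
      rintro ⟨a, ha⟩ ⟨b, hb⟩ t h
      simp only at h
      rw [Projectivization.mk_eq_mk_iff']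
      exact ⟨t ^ 2, by simp only [h, hF]⟩)

theorem quadraticMap_mk (F : (Fin 3 → ℂ) → (Fin 3 → ℂ)) (h0 : ∀ v, F v = 0 → v = 0)
    (hF : ∀ (t : ℂ) (v : Fin 3 → ℂ), F (t • v) = t ^ 2 • F v) (v : Fin 3 → ℂ) (hv : v ≠ 0) :
    quadraticMap F h0 hF (Projectivization.mk ℂ v hv)
      = Projectivization.mk ℂ (F v) (fun h => hv (h0 _ h)) := rfl

/-- The lift `(x, y, z) ↦ ((-x+y+z)², (x-y+z)², (x+y-z)²)` of `f₁`. -/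
def F₁ (v : Fin 3 → ℂ) : Fin 3 → ℂ :=
  ![(-v 0 + v 1 + v 2) ^ 2, (v 0 - v 1 + v 2) ^ 2, (v 0 + v 1 - v 2) ^ 2]

/-- The lift `(x, y, z) ↦ ((x-y+z)², (-x+y+z)², (x+y-z)²)` of `f₂`. -/
def F₂ (v : Fin 3 → ℂ) : Fin 3 → ℂ :=
  ![(v 0 - v 1 + v 2) ^ 2, (-v 0 + v 1 + v 2) ^ 2, (v 0 + v 1 - v 2) ^ 2]

/-- The lift `(x, y, z) ↦ ((x+y-z)², (-x+y+z)², (x-y+z)²)` of `f₃`. -/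
def F₃ (v : Fin 3 → ℂ) : Fin 3 → ℂ :=
  ![(v 0 + v 1 - v 2) ^ 2, (-v 0 + v 1 + v 2) ^ 2, (v 0 - v 1 + v 2) ^ 2]

theorem eq_zero_of_forms {v : Fin 3 → ℂ} (h1 : -v 0 + v 1 + v 2 = 0) (h2 : v 0 - v 1 + v 2 = 0)
    (h3 : v 0 + v 1 - v 2 = 0) : v = 0 := by
  funext j
  fin_cases j
  · show v 0 = 0
    linear_combination (h2 + h3) / 2
  · show v 1 = 0
    linear_combination (h1 + h3) / 2
  · show v 2 = 0
    linear_combination (h1 + h2) / 2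

theorem F₁_eq_zero (v : Fin 3 → ℂ) (h : F₁ v = 0) : v = 0 :=
  eq_zero_of_forms (by simpa [F₁] using congrFun h 0) (by simpa [F₁] using congrFun h 1)
    (by simpa [F₁] using congrFun h 2)

theorem F₂_eq_zero (v : Fin 3 → ℂ) (h : F₂ v = 0) : v = 0 :=
  eq_zero_of_forms (by simpa [F₂] using congrFun h 1) (by simpa [F₂] using congrFun h 0)
    (by simpa [F₂] using congrFun h 2)

theorem F₃_eq_zero (v : Fin 3 → ℂ) (h : F₃ v = 0) : v = 0 :=
  eq_zero_of_forms (by simpa [F₃] using congrFun h 1) (by simpa [F₃] using congrFun h 2)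
    (by simpa [F₃] using congrFun h 0)

theorem F₁_smul (t : ℂ) (v : Fin 3 → ℂ) : F₁ (t • v) = t ^ 2 • F₁ v := by
  funext j
  fin_cases j <;> simp [F₁] <;> ring

theorem F₂_smul (t : ℂ) (v : Fin 3 → ℂ) : F₂ (t • v) = t ^ 2 • F₂ v := by
  funext j
  fin_cases j <;> simp [F₂] <;> ring

theorem F₃_smul (t : ℂ) (v : Fin 3 → ℂ) : F₃ (t • v) = t ^ 2 • F₃ v := by
  funext j
  fin_cases j <;> simp [F₃] <;> ring

/-- `f₁ [x : y : z] = [(-x+y+z)² : (x-y+z)² : (x+y-z)²]`. -/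
def f₁ : ProjSpace 2 → ProjSpace 2 := quadraticMap F₁ F₁_eq_zero F₁_smul

/-- `f₂ [x : y : z] = [(x-y+z)² : (-x+y+z)² : (x+y-z)²]`. -/
def f₂ : ProjSpace 2 → ProjSpace 2 := quadraticMap F₂ F₂_eq_zero F₂_smul

/-- `f₃ [x : y : z] = [(x+y-z)² : (-x+y+z)² : (x-y+z)²]`. -/
def f₃ : ProjSpace 2 → ProjSpace 2 := quadraticMap F₃ F₃_eq_zero F₃_smul

/-- The lattice `(ℤ + iℤ)²` of `ℂ²`; the associated torus is `A_i × A_i`, `A_i = ℂ / (ℤ + iℤ)`. -/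
def gaussLattice : Submodule ℤ (Fin 2 → ℂ) :=
  Submodule.pi Set.univ (fun _ : Fin 2 => Submodule.span ℤ {(1 : ℂ), Complex.I})

/-- The self-map of `ℂ^k / Γ` induced by a matrix that maps `Γ` into itself. -/
def torusMap {k : ℕ} (Γ : Submodule ℤ (Fin k → ℂ)) (M : Matrix (Fin k) (Fin k) ℂ)
    (hM : ∀ v ∈ Γ, M *ᵥ v ∈ Γ) : Torus Γ → Torus Γ :=
  Γ.mapQ Γ (M.mulVecLin.restrictScalars ℤ) hM

theorem torusMap_toTorus {k : ℕ} (Γ : Submodule ℤ (Fin k → ℂ)) (M : Matrix (Fin k) (Fin k) ℂ)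
    (hM : ∀ v ∈ Γ, M *ᵥ v ∈ Γ) (v : Fin k → ℂ) :
    torusMap Γ M hM (toTorus Γ v) = toTorus Γ (M *ᵥ v) := rfl

/-- The matrix `D₁ = √2 · diag(e^{iπ/4}, e^{iπ/4})`. -/
def D₁ : Matrix (Fin 2) (Fin 2) ℂ :=
  ((√2 : ℝ) : ℂ) • !![Complex.exp (Complex.I * Real.pi / 4), 0;
    0, Complex.exp (Complex.I * Real.pi / 4)]

/-- The matrix `D₂`. -/
def D₂ : Matrix (Fin 2) (Fin 2) ℂ :=
  ((√2 : ℝ) : ℂ) • !![1 / ((√2 : ℝ) : ℂ), 1 / ((√2 : ℝ) : ℂ);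
    1 / ((√2 : ℝ) : ℂ), -1 / ((√2 : ℝ) : ℂ)]

/-- The matrix `D₃`. -/
def D₃ : Matrix (Fin 2) (Fin 2) ℂ :=
  ((√2 : ℝ) : ℂ) • !![1 / ((√2 : ℝ) : ℂ), 1 / ((√2 : ℝ) : ℂ);
    Complex.I / ((√2 : ℝ) : ℂ), -Complex.I / ((√2 : ℝ) : ℂ)]

theorem sqrtTwo_ne_zero : ((√2 : ℝ) : ℂ) ≠ 0 := by
  simp

theorem D₁_eq : D₁ = !![1 + Complex.I, 0; 0, 1 + Complex.I] := by
  have h : ((√2 : ℝ) : ℂ) * Complex.exp (Complex.I * Real.pi / 4) = 1 + Complex.I := by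
    have e : Complex.I * Real.pi / 4 = ((Real.pi / 4 : ℝ) : ℂ) * Complex.I := by
      push_cast; ring
    have s : ((√2 : ℝ) : ℂ) * ((√2 : ℝ) : ℂ) = 2 := by
      rw [← Complex.ofReal_mul, Real.mul_self_sqrt (by norm_num)]; norm_num
    rw [e, Complex.exp_mul_I, ← Complex.ofReal_cos, ← Complex.ofReal_sin, Real.cos_pi_div_four,
      Real.sin_pi_div_four]
    push_cast
    linear_combination (1 + Complex.I) / 2 * s
  ext i j
  fin_cases i <;> fin_cases j <;> simp [D₁, h]

theorem D₂_eq : D₂ = !![1, 1; 1, -1] := by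
  have s := sqrtTwo_ne_zero
  ext i j
  fin_cases i <;> fin_cases j <;> simp [D₂] <;> field_simp

theorem D₃_eq : D₃ = !![1, 1; Complex.I, -Complex.I] := by
  have s := sqrtTwo_ne_zero
  ext i j
  fin_cases i <;> fin_cases j <;> simp [D₃] <;> field_simp

theorem mem_gaussLattice {v : Fin 2 → ℂ} :
    v ∈ gaussLattice ↔ ∀ j, v j ∈ Submodule.span ℤ {(1 : ℂ), Complex.I} := by
  simp [gaussLattice, Submodule.mem_pi]

theorem I_mul_mem {z : ℂ} (hz : z ∈ Submodule.span ℤ {(1 : ℂ), Complex.I}) :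
    Complex.I * z ∈ Submodule.span ℤ {(1 : ℂ), Complex.I} := by
  rw [Submodule.mem_span_pair] at hz ⊢
  obtain ⟨a, b, rfl⟩ := hz
  refine ⟨-b, a, ?_⟩
  simp only [zsmul_eq_mul]
  push_cast
  linear_combination (-(b : ℂ)) * Complex.I_mul_I

theorem D₁_mem : ∀ v ∈ gaussLattice, D₁ *ᵥ v ∈ gaussLattice := by
  intro v hv
  rw [mem_gaussLattice] at hv ⊢
  rw [D₁_eq]
  intro j
  fin_cases j
  · simpa [add_mul, Matrix.vecHead, Matrix.vecTail] using add_mem (hv 0) (I_mul_mem (hv 0))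
  · simpa [add_mul, Matrix.vecHead, Matrix.vecTail] using add_mem (hv 1) (I_mul_mem (hv 1))

theorem D₂_mem : ∀ v ∈ gaussLattice, D₂ *ᵥ v ∈ gaussLattice := by
  intro v hv
  rw [mem_gaussLattice] at hv ⊢
  rw [D₂_eq]
  intro j
  fin_cases j
  · simpa [Matrix.vecHead, Matrix.vecTail] using add_mem (hv 0) (hv 1)
  · simpa [sub_eq_add_neg, Matrix.vecHead, Matrix.vecTail] using sub_mem (hv 0) (hv 1)

theorem D₃_mem : ∀ v ∈ gaussLattice, D₃ *ᵥ v ∈ gaussLattice := by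
  intro v hv
  rw [mem_gaussLattice] at hv ⊢
  rw [D₃_eq]
  intro j
  fin_cases j
  · simpa [Matrix.vecHead, Matrix.vecTail] using add_mem (hv 0) (hv 1)
  · simpa [sub_eq_add_neg, Matrix.vecHead, Matrix.vecTail] using sub_mem (I_mul_mem (hv 0)) (I_mul_mem (hv 1))

/-- The complex reflection group `G(m, p, 2)`, generated by the three matrices below. -/
def reflectionGroup (m p : ℕ) : Subgroup (GL (Fin 2) ℂ) :=
  Subgroup.closure {g |
    (g : Matrix (Fin 2) (Fin 2) ℂ) = !![0, 1; 1, 0] ∨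
    (g : Matrix (Fin 2) (Fin 2) ℂ) = !![0, Complex.exp (2 * Complex.I * Real.pi / m);
      Complex.exp (-(2 * Complex.I * Real.pi / m)), 0] ∨
    (g : Matrix (Fin 2) (Fin 2) ℂ) = !![Complex.exp (2 * Complex.I * p * Real.pi / m), 0; 0, 1]}

/-- The group `⟨G(4, 2, 2), (1+i)/2 · (1, 1)⟩` of automorphisms of `A_i × A_i`, generated by the
automorphisms induced by the elements of `G(4, 2, 2)` and by the translation of vector
`(1+i)/2 · (1, 1)`. -/
def coveringGroup : Subgroup (Equiv.Perm (Torus gaussLattice)) :=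
  Subgroup.closure
    ({e | ∃ g ∈ reflectionGroup 4 2, ∀ v : Fin 2 → ℂ,
        e (toTorus gaussLattice v)
          = toTorus gaussLattice ((g : Matrix (Fin 2) (Fin 2) ℂ) *ᵥ v)} ∪
      {Equiv.addRight (toTorus gaussLattice (((1 + Complex.I) / 2) • ![1, 1]))})

end Lattes

end

noncomputable section

/-! ### The Weierstrass function of a general lattice: differential equation, fibres, addition
theorem. -/

namespace PeriodPair

open Filter

variable (L : PeriodPair)

/-! The covering is built in three layers. Let `ell` be the Weierstrass function of `ℤ + iℤ`, scaled
so that its differential equation reads `ell'² = const · (ell³ - ell)`. It is even, surjective onto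
the affine line, and separates points up to sign modulo the lattice, so it identifies `A_i / ±1`
with `ℙ¹`. Hence `A_i × A_i` modulo sign changes of the coordinates is `ℙ¹ × ℙ¹`, and modulo the
swap as well it is the symmetric square of `ℙ¹`. The latter is `ℙ²`, with coordinates `A = p₁q₁ +
p₂q₂`, `B = p₁q₁ - p₂q₂`, `C = p₁q₂ + p₂q₁` (up to a linear change, the coefficients of a product of
two linear forms). What remains of the group acts as a Klein four-group: the scalar `i` acts by `ell
↦ -ell`, the translation by `(1+i)/2` by `ell ↦ -1/ell`, on both factors at once. On `(A, B, C)`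
these are sign changes, so squaring the coordinates finishes the quotient; `biform` is `(A², A² -
C², B²)`. The fibres are computed in `sameOrbit_of_coverLift_eq`, with `proportional_of_biform_eq`
as the algebraic core.

The semiconjugacies are identities for `ell`, all consequences of the addition theorem
`weierstrassP_add`: multiplication by `1 + i` for `f₁`, the sum and product of `ell (u + v)` and
`ell (u - v)` for `f₂`. The case of `f₃` follows from `f₂`, since an extra factor `i` on the second
coordinate exchanges `A²` and `B²`.

Critical finiteness is independent of the covering. Each map squares the three forms `linForm i`, in
some order. Its critical set is the union of their zero lines; these are mapped onto the coordinate
triangle, the triangle onto the three lines where two coordinates agree, and those lines into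
themselves. The postcritical set is therefore a union of six lines (`postcriticalSet_eq`). -/

theorem tendsto_weierstrassP_cobounded {l : ℂ} (hl : l ∈ L.lattice) :
    Tendsto ℘[L] (𝓝[≠] l) (Bornology.cobounded ℂ) := by
  apply tendsto_cobounded_of_meromorphicOrderAt_neg
  rw [L.order_weierstrassP l hl]
  decide

theorem isOpen_compl_lattice : IsOpen ((L.lattice : Set ℂ)ᶜ) := L.isClosed_lattice.isOpen_compl

theorem countable_lattice : (L.lattice : Set ℂ).Countable :=
  countable_of_Lindelof_of_discrete (X := L.lattice)

theorem isPreconnected_compl_lattice : IsPreconnected ((L.lattice : Set ℂ)ᶜ) :=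
  (L.countable_lattice.isConnected_compl_of_one_lt_rank (by simp)).2

theorem eventually_notMem_lattice (l : ℂ) : ∀ᶠ z in 𝓝[≠] l, z ∉ L.lattice := by
  filter_upwards [self_mem_nhdsWithin,
    mem_nhdsWithin_of_mem_nhds (L.compl_lattice_sdiff_singleton_mem_nhds l)] with z hz hz'
  simp_all

theorem hasDerivAt_weierstrassP {z : ℂ} (hz : z ∉ L.lattice) :
    HasDerivAt ℘[L] (℘'[L] z) z := by
  rw [← L.deriv_weierstrassP]
  exact (L.analyticOnNhd_weierstrassP z hz).differentiableAt.hasDerivAt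

/-- Differentiating the cubic equation gives this identity multiplied by `℘'`. On the connected
complement of the lattice one analytic factor must vanish identically, and it cannot be `℘'`, since
`℘` has poles. -/
theorem deriv_derivWeierstrassP {z : ℂ} (hz : z ∉ L.lattice) :
    deriv ℘'[L] z = 6 * ℘[L] z ^ 2 - L.g₂ / 2 := by
  have hP := L.analyticOnNhd_weierstrassP
  have hP' := L.analyticOnNhd_derivWeierstrassP
  have hmul : ∀ z ∈ (L.lattice : Set ℂ)ᶜ,
      ℘'[L] z * (deriv ℘'[L] z - (6 * ℘[L] z ^ 2 - L.g₂ / 2)) = 0 := by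
    intro z hz
    have h1 := ((hP' z hz).differentiableAt.hasDerivAt).pow 2
    have h2 := (((L.hasDerivAt_weierstrassP hz).pow 3).const_mul 4).sub
      ((L.hasDerivAt_weierstrassP hz).const_mul L.g₂) |>.sub_const L.g₃
    have h3 := h1.unique (h2.congr_of_eventuallyEq (by
      filter_upwards [L.isOpen_compl_lattice.mem_nhds hz] with w hw
      exact L.derivWeierstrassP_sq w hw))
    simp only [Nat.cast_ofNat, Nat.add_one_sub_one, pow_one] at h3
    linear_combination h3 / 2
  have hA : AnalyticOnNhd ℂ (fun z => deriv ℘'[L] z - (6 * ℘[L] z ^ 2 - L.g₂ / 2))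
      (L.lattice : Set ℂ)ᶜ := fun z hz =>
    ((hP' z hz).deriv).sub ((analyticAt_const.mul ((hP z hz).pow 2)).sub analyticAt_const)
  rcases AnalyticOnNhd.eq_zero_or_eq_zero_of_mul_eq_zero hP' hA hmul
    L.isPreconnected_compl_lattice with h | h
  · exfalso
    obtain ⟨a, ha⟩ := L.isOpen_compl_lattice.exists_is_const_of_deriv_eq_zero
      L.isPreconnected_compl_lattice L.differentiableOn_weierstrassP
      (fun z hz => by rw [L.deriv_weierstrassP]; exact h z hz)
    have h1 := L.tendsto_weierstrassP_cobounded (zero_mem _)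
    have h2 : Tendsto ℘[L] (𝓝[≠] 0) (𝓝 a) :=
      tendsto_const_nhds.congr' (by
        filter_upwards [L.eventually_notMem_lattice 0] with z hz using (ha z hz).symm)
    exact h2.not_tendsto (Metric.disjoint_nhds_cobounded a) h1
  · exact sub_eq_zero.mp (h z hz)

theorem hasDerivAt_derivWeierstrassP {z : ℂ} (hz : z ∉ L.lattice) :
    HasDerivAt ℘'[L] (6 * ℘[L] z ^ 2 - L.g₂ / 2) z := by
  rw [← L.deriv_derivWeierstrassP hz]
  exact (L.analyticOnNhd_derivWeierstrassP z hz).differentiableAt.hasDerivAt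

end PeriodPair

/-- A solution of `h'' = c h` with vanishing initial data vanishes. -/
theorem eventually_eq_zero_of_deriv_deriv_eq_mul {h c : ℂ → ℂ} {p : ℂ} (hh : AnalyticAt ℂ h p)
    (hc : AnalyticAt ℂ c p) (h0 : h p = 0) (h1 : deriv h p = 0)
    (hode : ∀ᶠ z in 𝓝 p, deriv (deriv h) z = c z * h z) : ∀ᶠ z in 𝓝 p, h z = 0 := by
  rw [← analyticOrderAt_eq_top]
  have e1 := hh.analyticOrderAt_deriv_add_one
  have e2 := hh.deriv.analyticOrderAt_deriv_add_one
  have e3 : analyticOrderAt (deriv (deriv h)) p = analyticOrderAt c p + analyticOrderAt h p := by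
    rw [← analyticOrderAt_mul hc hh]
    exact analyticOrderAt_congr hode
  simp only [h0, h1, sub_zero] at e1 e2
  change _ = analyticOrderAt h p at e1
  change _ = analyticOrderAt (deriv h) p at e2
  generalize analyticOrderAt h p = a at *
  generalize analyticOrderAt (deriv h) p = b at *
  rw [e3] at e2
  -- If the order of `h` were finite, that of `h''` would be smaller by two, whereas `c * h` has
  -- order at least that of `h`.
  by_contra ha
  lift a to ℕ using ha
  have hb : b ≠ ⊤ := by rintro rfl; simp at e1
  lift b to ℕ using hb
  have hc' : analyticOrderAt c p ≠ ⊤ := by intro h; rw [h] at e2; simp at e2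
  lift analyticOrderAt c p to ℕ using hc' with k
  norm_cast at e1 e2
  omega

namespace PeriodPair

open Filter

variable (L : PeriodPair)

/-- The translates `℘(z + u)` and `℘(z + v)` solve the same second-order equation with the same
initial data at `0`. Their difference `h` satisfies the linear equation `h'' = 6(℘(z + u) + ℘(z +
v)) h`, so it vanishes near `0`, hence wherever both are defined, and the poles must coincide. -/
theorem sub_mem_lattice_of_eq_of_deriv_eq {u v : ℂ} (hu : u ∉ L.lattice) (hv : v ∉ L.lattice)
    (h : ℘[L] u = ℘[L] v) (h' : ℘'[L] u = ℘'[L] v) : u - v ∈ L.lattice := by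
  have key : ∀ᶠ z in 𝓝 (0 : ℂ), ℘[L] (z + u) - ℘[L] (z + v) = 0 := by
    have n (w : ℂ) (hw : w ∉ L.lattice) : ∀ᶠ z in 𝓝 (0 : ℂ), z + w ∉ L.lattice :=
      (continuous_add_const w).continuousAt.eventually_mem
        (L.isOpen_compl_lattice.mem_nhds (by simpa using hw))
    have a (w : ℂ) (hw : w ∉ L.lattice) : AnalyticAt ℂ (fun z => ℘[L] (z + w)) 0 :=
      AnalyticAt.fun_comp (L.analyticOnNhd_weierstrassP _ (by simpa using hw)) (by fun_prop)
    have hd : ∀ᶠ z in 𝓝 (0 : ℂ), deriv (fun z => ℘[L] (z + u) - ℘[L] (z + v)) z =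
        ℘'[L] (z + u) - ℘'[L] (z + v) := by
      filter_upwards [n u hu, n v hv] with z hzu hzv
      exact (((L.hasDerivAt_weierstrassP hzu).comp_add_const z u).sub
        ((L.hasDerivAt_weierstrassP hzv).comp_add_const z v)).deriv
    refine eventually_eq_zero_of_deriv_deriv_eq_mul
      (c := fun z => 6 * (℘[L] (z + u) + ℘[L] (z + v))) ((a u hu).sub (a v hv))
      (analyticAt_const.mul ((a u hu).add (a v hv))) (by simp [h]) ?_ ?_
    · rw [hd.self_of_nhds]; simp [h']
    · filter_upwards [hd.eventually_nhds, n u hu, n v hv] with z hz hzu hzv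
      rw [EventuallyEq.deriv_eq hz]
      refine (((L.hasDerivAt_derivWeierstrassP hzu).comp_add_const z u).sub
        ((L.hasDerivAt_derivWeierstrassP hzv).comp_add_const z v)).deriv.trans ?_
      ring
  set U : Set ℂ := ((fun z => z - u) '' L.lattice ∪ (fun z => z - v) '' L.lattice)ᶜ with hU
  have hUmem (z : ℂ) : z ∈ U ↔ z + u ∉ L.lattice ∧ z + v ∉ L.lattice := by
    simp [hU, sub_eq_iff_eq_add]
  have hUc : IsPreconnected U :=
    (((L.countable_lattice.image _).union
      (L.countable_lattice.image _)).isConnected_compl_of_one_lt_rank (by simp)).2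
  have hUa : AnalyticOnNhd ℂ (fun z => ℘[L] (z + u) - ℘[L] (z + v)) U := fun z hz =>
    (AnalyticAt.fun_comp (f := fun z => z + u)
      (L.analyticOnNhd_weierstrassP _ ((hUmem z).1 hz).1) (by fun_prop)).sub
    (AnalyticAt.fun_comp (f := fun z => z + v)
      (L.analyticOnNhd_weierstrassP _ ((hUmem z).1 hz).2) (by fun_prop))
  have hzero := hUa.eqOn_zero_of_preconnected_of_eventuallyEq_zero hUc
    ((hUmem 0).2 (by simpa using ⟨hu, hv⟩)) key
  -- At `-u` the first translate has a pole; if `u - v` is not a period, the second is finite there.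
  by_contra hne
  have hw : -u + v ∉ L.lattice := fun hm => hne (by simpa [sub_eq_add_neg, add_comm] using neg_mem hm)
  have t1 : Tendsto (fun z => ℘[L] (z + v)) (𝓝[≠] (-u)) (𝓝 (℘[L] (-u + v))) :=
    (ContinuousAt.comp' (g := ℘[L]) (f := fun z => z + v)
      (L.analyticOnNhd_weierstrassP _ hw).continuousAt (by fun_prop)).tendsto.mono_left
      nhdsWithin_le_nhds
  have t2 : Tendsto (fun z => ℘[L] (z + u)) (𝓝[≠] (-u)) (Bornology.cobounded ℂ) := by
    refine (L.tendsto_weierstrassP_cobounded (zero_mem _)).comp ?_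
    refine tendsto_nhdsWithin_iff.2 ⟨?_, ?_⟩
    · exact ((continuous_add_const u).tendsto' _ _ (by simp)).mono_left nhdsWithin_le_nhds
    · filter_upwards [self_mem_nhdsWithin] with z hz h0
      exact hz (eq_neg_of_add_eq_zero_left h0)
  refine t1.not_tendsto (Metric.disjoint_nhds_cobounded _) (t2.congr' ?_)
  have m1 : ∀ᶠ z in 𝓝[≠] (-u), z + u ∉ L.lattice := by
    have : Tendsto (fun z => z + u) (𝓝[≠] (-u)) (𝓝[≠] 0) := by
      refine tendsto_nhdsWithin_iff.2 ⟨?_, ?_⟩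
      · exact ((continuous_add_const u).tendsto' _ _ (by simp)).mono_left nhdsWithin_le_nhds
      · filter_upwards [self_mem_nhdsWithin] with z hz h0
        exact hz (eq_neg_of_add_eq_zero_left h0)
    exact this.eventually (L.eventually_notMem_lattice 0)
  have m2 : ∀ᶠ z in 𝓝[≠] (-u), z + v ∉ L.lattice :=
    ((continuous_add_const v).continuousAt.eventually_mem
        (L.isOpen_compl_lattice.mem_nhds hw)).filter_mono nhdsWithin_le_nhds
  filter_upwards [m1, m2] with z h1 h2
  exact sub_eq_zero.1 (hzero ((hUmem z).2 ⟨h1, h2⟩))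

/-- Equal values of `℘` give equal values of `℘'²` by the cubic equation; since `℘'` is odd,
replacing `v` by `-v` settles the sign. -/
theorem weierstrassP_eq_iff {u v : ℂ} (hu : u ∉ L.lattice) (hv : v ∉ L.lattice) :
    ℘[L] u = ℘[L] v ↔ u - v ∈ L.lattice ∨ u + v ∈ L.lattice := by
  constructor
  · intro h
    have hsq : (℘'[L] u - ℘'[L] v) * (℘'[L] u + ℘'[L] v) = 0 := by
      have e1 := L.derivWeierstrassP_sq u hu
      have e2 := L.derivWeierstrassP_sq v hv
      rw [h] at e1
      linear_combination e1 - e2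
    rcases mul_eq_zero.1 hsq with h' | h'
    · exact .inl (L.sub_mem_lattice_of_eq_of_deriv_eq hu hv h (sub_eq_zero.1 h'))
    · refine .inr ?_
      simpa using L.sub_mem_lattice_of_eq_of_deriv_eq (v := -v) hu (by simpa using hv)
        (by simpa using h) (by simpa using eq_neg_of_add_eq_zero_left h')
  · rintro (h | h)
    · simpa using (L.weierstrassP_add_coe v ⟨_, h⟩)
    · have := L.weierstrassP_add_coe (-v) ⟨_, h⟩
      simpa using this

/-- Liouville: if `c` were omitted, `1 / (℘ - c)`, extended by `0` at the poles, would be entire and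
periodic, hence bounded and constant; but it is nonzero off the lattice. -/
theorem exists_weierstrassP_eq (c : ℂ) : ∃ z, z ∉ L.lattice ∧ ℘[L] z = c := by
  by_contra! hc
  classical
  set f : ℂ → ℂ := fun z => if z ∈ L.lattice then 0 else (℘[L] z - c)⁻¹ with hf
  have hd : ∀ z, z ∉ L.lattice → DifferentiableAt ℂ f z := by
    intro z hz
    have : DifferentiableAt ℂ (fun z => (℘[L] z - c)⁻¹) z :=
      ((L.hasDerivAt_weierstrassP hz).differentiableAt.sub_const c).inv
        (sub_ne_zero.2 (hc z hz))
    refine this.congr_of_eventuallyEq ?_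
    filter_upwards [L.isOpen_compl_lattice.mem_nhds hz] with w hw
    exact if_neg hw
  have hdiff : Differentiable ℂ f := by
    intro z
    by_cases hz : z ∈ L.lattice
    · refine AnalyticAt.differentiableAt
        (Complex.analyticAt_of_differentiable_on_punctured_nhds_of_continuousAt ?_ ?_)
      · filter_upwards [L.eventually_notMem_lattice z] with w hw using hd w hw
      · refine continuousAt_iff_punctured_nhds.2 ?_
        have : Tendsto (fun w => (℘[L] w - c)⁻¹) (𝓝[≠] z) (𝓝 0) :=
          tendsto_inv₀_cobounded.comp
            ((tendsto_sub_const_cobounded c).comp (L.tendsto_weierstrassP_cobounded hz))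
        rw [show f z = 0 from if_pos hz]
        refine this.congr' ?_
        filter_upwards [L.eventually_notMem_lattice z] with w hw
        exact (if_neg hw).symm
    · exact hd z hz
  have hper : ∀ z w, w ∈ L.lattice → f (z + w) = f z := by
    intro z w hw
    have h1 : z + w ∈ L.lattice ↔ z ∈ L.lattice := by
      simpa using L.lattice.toAddSubgroup.add_mem_cancel_right (y := z) hw
    have h2 := L.weierstrassP_add_coe z ⟨w, hw⟩
    simp only at h2
    simp only [hf, h1, h2]
  have hconst := hdiff.apply_eq_apply_of_bounded
    (IsZLattice.isCompact_range_of_periodic L.lattice f hdiff.continuous hper).isBounded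
    (L.ω₁ / 2) 0
  have h2 := L.ω₁_div_two_notMem_lattice
  simp only [hf, h2, if_false, zero_mem, if_true, inv_eq_zero] at hconst
  exact hc _ h2 (sub_eq_zero.1 hconst)

/-- For a fixed sum `s`, the right-hand side of the addition theorem has zero derivative in `u`, by
the two differential equations. Its domain has countable complement, hence is connected, so the
expression is constant. -/
theorem weierstrassP_add_aux {s : ℂ} (hs : s ∉ L.lattice) :
    ∃ a : ℂ, ∀ u, u ∉ L.lattice → s - u ∉ L.lattice → ℘[L] u - ℘[L] (s - u) ≠ 0 →
      ((℘'[L] u - ℘'[L] (s - u)) / (℘[L] u - ℘[L] (s - u))) ^ 2 / 4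
        - ℘[L] u - ℘[L] (s - u) = a := by
  set U : Set ℂ := {u | u ∉ L.lattice ∧ s - u ∉ L.lattice ∧ ℘[L] u - ℘[L] (s - u) ≠ 0} with hU
  have hUeq : Uᶜ = (L.lattice : Set ℂ) ∪ (fun z => s - z) '' L.lattice ∪
      (fun z => (z + s) / 2) '' L.lattice := by
    ext u
    simp only [hU, Set.mem_compl_iff, Set.mem_ofPred_eq, Set.mem_union, SetLike.mem_coe,
      Set.mem_image]
    have e1 : (∃ x ∈ L.lattice, s - x = u) ↔ s - u ∈ L.lattice :=
      ⟨by rintro ⟨x, hx, rfl⟩; simpa using hx, fun h => ⟨_, h, by ring⟩⟩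
    have e2 : (∃ x ∈ L.lattice, (x + s) / 2 = u) ↔ u - (s - u) ∈ L.lattice := by
      constructor
      · rintro ⟨x, hx, rfl⟩
        convert hx using 1
        ring
      · exact fun h => ⟨_, h, by ring⟩
    rw [e1, e2]
    by_cases h1 : u ∈ L.lattice
    · simp [h1]
    by_cases h2 : s - u ∈ L.lattice
    · simp [h2]
    have := L.weierstrassP_eq_iff h1 h2
    rw [show u + (s - u) = s by ring] at this
    simp [h1, h2, sub_eq_zero, this, hs]
  have hUconn : IsPreconnected U := by
    rw [← compl_compl U, hUeq]
    exact (((L.countable_lattice.union (L.countable_lattice.image _)).union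
      (L.countable_lattice.image _)).isConnected_compl_of_one_lt_rank (by simp)).2
  have hder : ∀ u ∈ U, HasDerivAt (fun u => ((℘'[L] u - ℘'[L] (s - u)) /
      (℘[L] u - ℘[L] (s - u))) ^ 2 / 4 - ℘[L] u - ℘[L] (s - u)) 0 u := by
    rintro u ⟨h1, h2, h3⟩
    have d1 := L.hasDerivAt_weierstrassP h1
    have d2 := (L.hasDerivAt_weierstrassP h2).comp_const_sub s u
    have d3 := L.hasDerivAt_derivWeierstrassP h1
    have d4 := (L.hasDerivAt_derivWeierstrassP h2).comp_const_sub s u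
    refine (((((d3.sub d4).div (d1.sub d2) h3).pow 2).div_const 4).sub d1 |>.sub d2).congr_deriv ?_
    have q1 := L.derivWeierstrassP_sq u h1
    have q2 := L.derivWeierstrassP_sq (s - u) h2
    simp only [Pi.sub_apply, Pi.div_apply]
    generalize ℘[L] u = x at *
    generalize ℘[L] (s - u) = y at *
    generalize ℘'[L] u = p at *
    generalize ℘'[L] (s - u) = q at *
    norm_num only [pow_one]
    field_simp
    linear_combination (-2 * (p - q)) * (q1 - q2)
  have hopen : IsOpen U := by
    have c : ContinuousOn (fun u => ℘[L] u - ℘[L] (s - u))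
        ((L.lattice : Set ℂ)ᶜ ∩ (fun u => s - u) ⁻¹' (L.lattice : Set ℂ)ᶜ) :=
      (L.differentiableOn_weierstrassP.continuousOn.mono Set.inter_subset_left).sub
        (L.differentiableOn_weierstrassP.continuousOn.comp (by fun_prop)
          (fun u hu => hu.2))
    have o := L.isOpen_compl_lattice
    convert c.isOpen_inter_preimage (o.inter (o.preimage (by fun_prop))) (isOpen_ne (x := (0 : ℂ)))
      using 1
    ext u
    simp [hU, and_assoc]
  obtain ⟨a, ha⟩ := hopen.exists_is_const_of_deriv_eq_zero hUconn
    (fun u hu => (hder u hu).differentiableAt.differentiableWithinAt) (fun u hu => (hder u hu).deriv)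
  exact ⟨a, fun u h1 h2 h3 => ha u ⟨h1, h2, h3⟩⟩

/-- The addition theorem for the Weierstrass function. -/
theorem weierstrassP_add {u v : ℂ} (hu : u ∉ L.lattice) (hv : v ∉ L.lattice)
    (hadd : u + v ∉ L.lattice) (hsub : u - v ∉ L.lattice) :
    ℘[L] (u + v) =
      ((℘'[L] u - ℘'[L] v) / (℘[L] u - ℘[L] v)) ^ 2 / 4 - ℘[L] u - ℘[L] v := by
  obtain ⟨a, ha⟩ := L.weierstrassP_add_aux hadd
  have h0 := ha u hu (by simpa using hv) (by
    rw [add_sub_cancel_left, sub_ne_zero, ne_eq, L.weierstrassP_eq_iff hu hv]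
    tauto)
  rw [add_sub_cancel_left] at h0
  rw [h0]
  -- It remains to identify the constant `a` with `℘ s`, by letting one summand `v` tend to the pole
  -- at `0`.
  generalize u + v = s at *
  have n1 : ∀ᶠ v in 𝓝[≠] (0 : ℂ), v ∉ L.lattice := L.eventually_notMem_lattice 0
  have n2 (k : ℂ) : ∀ᶠ v in 𝓝[≠] (0 : ℂ), s - k * v ∉ L.lattice := by
    have : ContinuousAt (fun v => s - k * v) 0 := by fun_prop
    exact (this.eventually_mem (L.isOpen_compl_lattice.mem_nhds
      (by simpa using hadd))).filter_mono nhdsWithin_le_nhds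
  have hε : Tendsto (fun v => (℘[L] v)⁻¹) (𝓝[≠] 0) (𝓝 0) :=
    tendsto_inv₀_cobounded.comp (L.tendsto_weierstrassP_cobounded (zero_mem _))
  have hne : ∀ᶠ v in 𝓝[≠] (0 : ℂ), ℘[L] v ≠ 0 :=
    (L.tendsto_weierstrassP_cobounded (zero_mem _)).eventually_ne_cobounded 0
  -- With `ε = 1/℘`, the cubic equation makes the square of this function equal to `4ε - g₂ε³ -
  -- g₃ε⁴`.
  have hδ : Tendsto (fun v => ℘'[L] v * (℘[L] v)⁻¹ ^ 2) (𝓝[≠] 0) (𝓝 0) := by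
    have h2 : Tendsto (fun v => (℘'[L] v * (℘[L] v)⁻¹ ^ 2) ^ 2) (𝓝[≠] 0) (𝓝 0) := by
      have : Tendsto (fun v => 4 * (℘[L] v)⁻¹ - L.g₂ * (℘[L] v)⁻¹ ^ 3 - L.g₃ * (℘[L] v)⁻¹ ^ 4)
          (𝓝[≠] 0) (𝓝 (4 * 0 - L.g₂ * 0 ^ 3 - L.g₃ * 0 ^ 4)) :=
        ((hε.const_mul 4).sub ((hε.pow 3).const_mul _)).sub ((hε.pow 4).const_mul _)
      simp only [mul_zero, ne_eq, OfNat.ofNat_ne_zero, not_false_eq_true, zero_pow, sub_zero] at this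
      refine this.congr' ?_
      filter_upwards [n1, hne] with v hv hv'
      rw [mul_pow, L.derivWeierstrassP_sq v hv]
      field_simp
    rw [tendsto_zero_iff_norm_tendsto_zero] at h2 ⊢
    have h3 := h2.sqrt
    simp only [norm_pow, Real.sqrt_zero] at h3
    exact h3.congr fun v => Real.sqrt_sq (norm_nonneg _)
  have cP : Tendsto (fun v => ℘[L] (s - v)) (𝓝[≠] 0) (𝓝 (℘[L] s)) := by
    have : ContinuousAt (fun v => ℘[L] (s - v)) 0 :=
      ContinuousAt.comp' (g := ℘[L])
        (by simpa using (L.analyticOnNhd_weierstrassP _ hadd).continuousAt) (by fun_prop)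
    simpa using this.tendsto.mono_left nhdsWithin_le_nhds
  have cP' : Tendsto (fun v => ℘'[L] (s - v)) (𝓝[≠] 0) (𝓝 (℘'[L] s)) := by
    have : ContinuousAt (fun v => ℘'[L] (s - v)) 0 :=
      ContinuousAt.comp' (g := ℘'[L])
        (by simpa using (L.analyticOnNhd_derivWeierstrassP _ hadd).continuousAt) (by fun_prop)
    simpa using this.tendsto.mono_left nhdsWithin_le_nhds
  -- This is the constancy relation with denominators cleared, the terms `4 ℘(v)³` cancelled, and
  -- everything divided by `℘(v)²`. In the limit it becomes `4 ℘(s) = 4a`.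
  have lhs := ((((((cP'.pow 2).mul (hε.pow 2)).sub ((cP'.mul hδ).const_mul 2)).sub
    (hε.const_mul L.g₂)).sub ((hε.pow 2).const_mul L.g₃)).sub
    (((cP.pow 3).mul (hε.pow 2)).const_mul 4)).add (((cP.pow 2).mul hε).const_mul 4) |>.add
    (cP.const_mul 4)
  have rhs := (((cP.mul hε).sub_const 1).pow 2).const_mul (4 * a)
  have := tendsto_nhds_unique (lhs.congr' ?_) rhs
  · linear_combination this / 4
  · filter_upwards [n1, n2 1, n2 2, hne] with v h1 h2 h3 h4
    rw [one_mul] at h2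
    have h5 : ℘[L] (s - v) - ℘[L] v ≠ 0 := by
      rw [sub_ne_zero, ne_eq, L.weierstrassP_eq_iff h2 h1, sub_add_cancel,
        show s - v - v = s - 2 * v by ring]
      tauto
    have h6 := ha (s - v) h2 (by simpa using h1) (by simpa using h5)
    rw [sub_sub_cancel] at h6
    have h7 := L.derivWeierstrassP_sq v h1
    rw [← h6]
    field_simp
    linear_combination -h7

end PeriodPair

/-! ### The square lattice and its extra symmetry. -/

namespace Lattes

open PeriodPair

/-- The period pair `(1, i)` of the lattice of Gaussian integers. -/
def gaussPair : PeriodPair where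
  ω₁ := 1
  ω₂ := Complex.I
  indep := by
    rw [LinearIndependent.pair_iff]
    intro s t h
    have h1 := congrArg Complex.re h
    have h2 := congrArg Complex.im h
    simp at h1 h2
    exact ⟨h1, h2⟩

/-- The lattice `ℤ + iℤ` of Gaussian integers. -/
abbrev gaussInt : Submodule ℤ ℂ := gaussPair.lattice

theorem mem_gaussInt {z : ℂ} : z ∈ gaussInt ↔ ∃ m n : ℤ, (m : ℂ) + n * Complex.I = z := by
  rw [PeriodPair.mem_lattice]
  simp [gaussPair]

theorem one_mem_gaussInt : (1 : ℂ) ∈ gaussInt := gaussPair.ω₁_mem_lattice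

theorem I_mem_gaussInt : Complex.I ∈ gaussInt := gaussPair.ω₂_mem_lattice

theorem mul_mem_gaussInt {z w : ℂ} (hz : z ∈ gaussInt) (hw : w ∈ gaussInt) :
    z * w ∈ gaussInt := by
  rw [mem_gaussInt] at *
  obtain ⟨a, b, rfl⟩ := hz
  obtain ⟨c, d, rfl⟩ := hw
  refine ⟨a * c - b * d, a * d + b * c, ?_⟩
  push_cast
  linear_combination (-(b : ℂ) * d) * Complex.I_mul_I

theorem I_mul_mem_gaussInt_iff {z : ℂ} : Complex.I * z ∈ gaussInt ↔ z ∈ gaussInt := by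
  refine ⟨fun h => ?_, fun h => mul_mem_gaussInt I_mem_gaussInt h⟩
  have h2 := neg_mem (mul_mem_gaussInt I_mem_gaussInt h)
  rwa [← mul_assoc, Complex.I_mul_I, neg_one_mul, neg_neg] at h2

/-- Multiplication by `i` on the Gaussian integers. -/
def gaussMulI : gaussInt ≃ gaussInt where
  toFun l := ⟨Complex.I * l, I_mul_mem_gaussInt_iff.2 l.2⟩
  invFun l := ⟨-(Complex.I * l), neg_mem (I_mul_mem_gaussInt_iff.2 l.2)⟩
  left_inv l := by
    ext1
    linear_combination (-(l : ℂ)) * Complex.I_mul_I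
  right_inv l := by
    ext1
    linear_combination (-(l : ℂ)) * Complex.I_mul_I

/-- The lattice is stable under `i`, so the defining series may be reindexed by `l ↦ i l`; each term
is homogeneous of degree `-2`. -/
theorem weierstrassP_I_mul (z : ℂ) : ℘[gaussPair] (Complex.I * z) = -℘[gaussPair] z := by
  simp only [weierstrassP]
  rw [← gaussMulI.tsum_eq, ← tsum_neg]
  congr with l
  simp only [gaussMulI, Equiv.coe_fn_mk, ← mul_sub, mul_pow, Complex.I_sq, neg_one_mul, div_neg]
  ring

theorem derivWeierstrassP_I_mul (z : ℂ) :
    ℘'[gaussPair] (Complex.I * z) = Complex.I * ℘'[gaussPair] z := by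
  simp only [derivWeierstrassP]
  rw [← gaussMulI.tsum_eq, mul_neg, ← tsum_mul_left]
  congr with l
  simp only [gaussMulI, Equiv.coe_fn_mk, ← mul_sub, mul_pow, Complex.I_pow_three]
  rw [div_eq_mul_inv, mul_inv, inv_neg, Complex.inv_I]
  ring

theorem half_notMem_gaussInt : (1 / 2 : ℂ) ∉ gaussInt := gaussPair.ω₁_div_two_notMem_lattice

/-- The half period `(1 + i) / 2`. -/
def tau : ℂ := (1 + Complex.I) / 2

theorem tau_notMem : tau ∉ gaussInt := by
  have := (gaussPair.mul_ω₁_add_mul_ω₂_mem_lattice (α := 1 / 2) (β := 1 / 2)).not.mpr (by norm_num)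
  have e : tau = ((1 / 2 : ℚ) : ℂ) * gaussPair.ω₁ + ((1 / 2 : ℚ) : ℂ) * gaussPair.ω₂ := by
    simp only [tau, gaussPair]
    push_cast
    ring
  rwa [e]

theorem two_mul_tau_mem : 2 * tau ∈ gaussInt := by
  rw [mem_gaussInt]
  exact ⟨1, 1, by rw [tau]; push_cast; ring⟩

theorem add_two_mul_tau_mem_iff {z : ℂ} : z + 2 * tau ∈ gaussInt ↔ z ∈ gaussInt := by
  simpa using gaussInt.toAddSubgroup.add_mem_cancel_right (y := z) two_mul_tau_mem

theorem I_mul_tau : Complex.I * tau = tau - 1 := by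
  rw [tau]
  linear_combination Complex.I_mul_I / 2

theorem weierstrassP_sub_mem {z w : ℂ} (h : z - w ∈ gaussInt) :
    ℘[gaussPair] z = ℘[gaussPair] w := by
  simpa using gaussPair.weierstrassP_add_coe w ⟨_, h⟩

theorem derivWeierstrassP_sub_mem {z w : ℂ} (h : z - w ∈ gaussInt) :
    ℘'[gaussPair] z = ℘'[gaussPair] w := by
  simpa using gaussPair.derivWeierstrassP_add_coe w ⟨_, h⟩

/-- Multiplication by `i` fixes `tau` modulo the lattice but changes the sign of `℘`. -/
theorem weierstrassP_tau : ℘[gaussPair] tau = 0 := by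
  have h1 := weierstrassP_I_mul tau
  rw [I_mul_tau, weierstrassP_sub_mem (w := tau) (by simpa using one_mem_gaussInt)] at h1
  linear_combination h1 / 2

theorem derivWeierstrassP_eq_zero {z : ℂ} (h : 2 * z ∈ gaussInt) : ℘'[gaussPair] z = 0 := by
  have h1 := gaussPair.derivWeierstrassP_neg z
  rw [← derivWeierstrassP_sub_mem (z := z) (w := -z) (by convert h using 1; ring)] at h1
  linear_combination h1 / 2

theorem gaussPair_g₃ : gaussPair.g₃ = 0 := by
  have h1 := gaussPair.derivWeierstrassP_sq tau tau_notMem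
  rw [derivWeierstrassP_eq_zero two_mul_tau_mem, weierstrassP_tau] at h1
  linear_combination h1

/-- The value of `℘` at the half period `1 / 2`. -/
def e₁ : ℂ := ℘[gaussPair] (1 / 2)

theorem e₁_ne_zero : e₁ ≠ 0 := by
  intro h
  rw [e₁, ← weierstrassP_tau, gaussPair.weierstrassP_eq_iff half_notMem_gaussInt tau_notMem] at h
  rcases h with h | h
  · refine half_notMem_gaussInt (I_mul_mem_gaussInt_iff.1 ?_)
    convert neg_mem h using 1
    rw [tau]
    ring
  · refine half_notMem_gaussInt (I_mul_mem_gaussInt_iff.1 ?_)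
    convert sub_mem h one_mem_gaussInt using 1
    rw [tau]
    ring

/-- `℘'` vanishes at the half period `1/2`, so `e₁` is a nonzero root of `4x³ - g₂x`. -/
theorem gaussPair_g₂ : gaussPair.g₂ = 4 * e₁ ^ 2 := by
  have h1 := gaussPair.derivWeierstrassP_sq _ half_notMem_gaussInt
  rw [derivWeierstrassP_eq_zero (by simpa using one_mem_gaussInt), gaussPair_g₃] at h1
  change 0 ^ 2 = 4 * e₁ ^ 3 - _ * e₁ - 0 at h1
  refine mul_right_cancel₀ e₁_ne_zero ?_
  linear_combination h1

theorem derivWeierstrassP_sq_gaussPair {z : ℂ} (hz : z ∉ gaussInt) :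
    ℘'[gaussPair] z ^ 2 = 4 * ℘[gaussPair] z ^ 3 - 4 * e₁ ^ 2 * ℘[gaussPair] z := by
  rw [gaussPair.derivWeierstrassP_sq z hz, gaussPair_g₃, gaussPair_g₂, sub_zero]

/-! ### Algebraic identities for the normalized function. -/

/-- The Weierstrass function of the Gaussian integers, normalized to take the values
`1, -1, 0` at the nonzero half periods. -/
def ell (z : ℂ) : ℂ := ℘[gaussPair] z / e₁

theorem weierstrassP_eq_ell (z : ℂ) : ℘[gaussPair] z = e₁ * ell z := by
  rw [ell, mul_div_cancel₀ _ e₁_ne_zero]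

theorem ell_sub_mem {z w : ℂ} (h : z - w ∈ gaussInt) : ell z = ell w := by
  rw [ell, ell, weierstrassP_sub_mem h]

theorem ell_neg (z : ℂ) : ell (-z) = ell z := by
  rw [ell, ell, weierstrassP_neg]

theorem ell_I_mul (z : ℂ) : ell (Complex.I * z) = -ell z := by
  rw [ell, ell, weierstrassP_I_mul, neg_div]

theorem ell_tau : ell tau = 0 := by
  rw [ell, weierstrassP_tau, zero_div]

theorem ell_eq_iff {u v : ℂ} (hu : u ∉ gaussInt) (hv : v ∉ gaussInt) :
    ell u = ell v ↔ u - v ∈ gaussInt ∨ u + v ∈ gaussInt := by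
  rw [ell, ell, div_left_inj' e₁_ne_zero, gaussPair.weierstrassP_eq_iff hu hv]

theorem exists_ell_eq (c : ℂ) : ∃ z, z ∉ gaussInt ∧ ell z = c := by
  obtain ⟨z, hz, h⟩ := gaussPair.exists_weierstrassP_eq (e₁ * c)
  exact ⟨z, hz, by rw [ell, h, mul_div_cancel_left₀ _ e₁_ne_zero]⟩

theorem differentiableAt_ell {z : ℂ} (hz : z ∉ gaussInt) : DifferentiableAt ℂ ell z :=
  (gaussPair.hasDerivAt_weierstrassP hz).differentiableAt.div_const e₁

theorem ell_add_mul {u v : ℂ} (hu : u ∉ gaussInt) (hv : v ∉ gaussInt)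
    (hadd : u + v ∉ gaussInt) (hsub : u - v ∉ gaussInt) :
    4 * e₁ ^ 3 * (ell (u + v) + ell u + ell v) * (ell u - ell v) ^ 2 =
      (℘'[gaussPair] u - ℘'[gaussPair] v) ^ 2 := by
  have h := gaussPair.weierstrassP_add hu hv hadd hsub
  have hne : ell u - ell v ≠ 0 := by
    rw [sub_ne_zero, ne_eq, ell_eq_iff hu hv]
    tauto
  have he := e₁_ne_zero
  simp only [weierstrassP_eq_ell, ← mul_sub] at h
  rw [sub_sub, eq_sub_iff_add_eq, div_pow, div_div, eq_div_iff (by simp [he, hne])] at h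
  linear_combination h

theorem ell_sq {z : ℂ} (hz : z ∉ gaussInt) :
    ℘'[gaussPair] z ^ 2 = 4 * e₁ ^ 3 * (ell z ^ 3 - ell z) := by
  have h := derivWeierstrassP_sq_gaussPair hz
  rw [weierstrassP_eq_ell] at h
  linear_combination h

theorem ell_ne_zero {z : ℂ} (hz : z ∉ gaussInt) (h : z + tau ∉ gaussInt) : ell z ≠ 0 := by
  rw [← ell_tau, ne_eq, ell_eq_iff hz tau_notMem, not_or]
  refine ⟨fun h' => h ?_, h⟩
  convert add_mem h' two_mul_tau_mem using 1
  ring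

/-- Addition theorem with second argument `tau`, where both `ell` and `℘'` vanish: translation by
`tau` acts on `ℙ¹` as `x ↦ -1/x`. -/
theorem ell_mul_ell_add_tau {z : ℂ} (hz : z ∉ gaussInt) (h : z + tau ∉ gaussInt) :
    ell z * ell (z + tau) = -1 := by
  have h1 := ell_add_mul hz tau_notMem h (fun h' => h (by
    convert add_mem h' two_mul_tau_mem using 1
    ring))
  rw [derivWeierstrassP_eq_zero two_mul_tau_mem, ell_tau, sub_zero, sub_zero, ell_sq hz] at h1
  have he := e₁_ne_zero
  have hz0 := ell_ne_zero hz h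
  refine mul_left_cancel₀ (a := 4 * e₁ ^ 3 * ell z) (by simp [he, hz0]) ?_
  linear_combination h1

/-- Addition theorem for `z` and `iz`: complex multiplication expresses everything through `ell z`.
-/
theorem ell_one_add_I_mul {z : ℂ} (hz : z ∉ gaussInt) (h : (1 + Complex.I) * z ∉ gaussInt) :
    2 * Complex.I * ell z * ell ((1 + Complex.I) * z) = ell z ^ 2 - 1 := by
  have e : z + Complex.I * z = (1 + Complex.I) * z := by ring
  have hs : z - Complex.I * z ∉ gaussInt := fun h' => h (by
    convert mul_mem_gaussInt I_mem_gaussInt h' using 1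
    linear_combination z * Complex.I_mul_I)
  have hI : Complex.I * z ∉ gaussInt := by rwa [I_mul_mem_gaussInt_iff]
  have hne : ell z ≠ 0 := by
    intro h0
    have := (ell_eq_iff hz hI).1 (by rw [ell_I_mul, h0, neg_zero])
    rw [e] at this
    tauto
  have h1 := ell_add_mul hz hI (by rwa [e]) hs
  rw [e, ell_I_mul, derivWeierstrassP_I_mul] at h1
  have h2 := ell_sq hz
  have he := e₁_ne_zero
  refine mul_left_cancel₀ (a := 8 * e₁ ^ 3 * ell z) (by simp [he, hne]) ?_
  linear_combination Complex.I * h1 + Complex.I * (1 - Complex.I) ^ 2 * h2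
    + (4 * (Complex.I - 2) * e₁ ^ 3 * (ell z ^ 3 - ell z)) * Complex.I_mul_I

/-- Adding the addition formulas for `v` and `-v` cancels the mixed term `℘'(u) ℘'(v)`. -/
theorem ell_add_add_ell_sub {u v : ℂ} (hu : u ∉ gaussInt) (hv : v ∉ gaussInt)
    (hadd : u + v ∉ gaussInt) (hsub : u - v ∉ gaussInt) :
    (ell (u + v) + ell (u - v)) * (ell u - ell v) ^ 2 =
      2 * (ell u + ell v) * (ell u * ell v - 1) := by
  have h1 := ell_add_mul hu hv hadd hsub
  have h2 := ell_add_mul (v := -v) hu (by simpa using hv) (by rwa [← sub_eq_add_neg])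
    (by rwa [sub_neg_eq_add])
  rw [ell_neg, derivWeierstrassP_neg, ← sub_eq_add_neg] at h2
  have h3 := ell_sq hu
  have h4 := ell_sq hv
  have he := e₁_ne_zero
  refine mul_left_cancel₀ (a := 4 * e₁ ^ 3) (by simp [he]) ?_
  linear_combination h1 + h2 + 2 * h3 + 2 * h4

/-- Multiplying the addition formulas for `v` and `-v` leaves `(℘'(u)² - ℘'(v)²)²`, which is
polynomial in `ell u` and `ell v`; the sum formula then isolates the product. -/
theorem ell_add_mul_ell_sub {u v : ℂ} (hu : u ∉ gaussInt) (hv : v ∉ gaussInt)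
    (hadd : u + v ∉ gaussInt) (hsub : u - v ∉ gaussInt) :
    (ell (u + v) * ell (u - v)) * (ell u - ell v) ^ 2 = (ell u * ell v + 1) ^ 2 := by
  have h1 := ell_add_mul hu hv hadd hsub
  have h2 := ell_add_mul (v := -v) hu (by simpa using hv) (by rwa [← sub_eq_add_neg])
    (by rwa [sub_neg_eq_add])
  rw [ell_neg, derivWeierstrassP_neg, ← sub_eq_add_neg] at h2
  have h3 := ell_sq hu
  have h4 := ell_sq hv
  have he := e₁_ne_zero
  have hne : ell u - ell v ≠ 0 := by
    rw [sub_ne_zero, ne_eq, ell_eq_iff hu hv]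
    tauto
  generalize ell u = x at *
  generalize ell v = y at *
  generalize ell (u + v) = a at *
  generalize ell (u - v) = b at *
  generalize ℘'[gaussPair] u = p at *
  generalize ℘'[gaussPair] v = q at *
  have h5 : (4 * e₁ ^ 3 * (a + x + y) * (x - y) ^ 2) * (4 * e₁ ^ 3 * (b + x + y) * (x - y) ^ 2) =
      (4 * e₁ ^ 3) ^ 2 * (x ^ 3 - x - (y ^ 3 - y)) ^ 2 := by
    rw [h1, h2]
    have : (p - q) ^ 2 * (p - -q) ^ 2 = (p ^ 2 - q ^ 2) ^ 2 := by ring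
    rw [this, h3, h4]
    ring
  have h6 : (a + b) * (x - y) ^ 2 = 2 * (x + y) * (x * y - 1) := by
    refine mul_left_cancel₀ (a := 4 * e₁ ^ 3) (by simp [he]) ?_
    linear_combination h1 + h2 + 2 * h3 + 2 * h4
  have h7 : (a + x + y) * (b + x + y) * (x - y) ^ 4 = (x ^ 3 - x - (y ^ 3 - y)) ^ 2 := by
    refine mul_left_cancel₀ (a := (4 * e₁ ^ 3) ^ 2) (by simp [he]) ?_
    linear_combination h5
  refine mul_left_cancel₀ (a := (x - y) ^ 2) (by simp [hne]) ?_
  linear_combination h7 - (x + y) * (x - y) ^ 2 * h6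

/-! ### The quotient of `ℙ¹ × ℙ¹` by the swap and a Klein four-group. -/

/-- Two vectors of `ℂ²` are proportional if they are nonzero multiples of each other. -/
def Proportional (p q : ℂ × ℂ) : Prop := ∃ c : ℂ, c ≠ 0 ∧ p = c • q

theorem Proportional.refl (p : ℂ × ℂ) : Proportional p p := ⟨1, one_ne_zero, (one_smul _ _).symm⟩

theorem Proportional.of_eq {p q : ℂ × ℂ} (h : p = q) : Proportional p q := h ▸ .refl p

theorem Proportional.symm {p q : ℂ × ℂ} (h : Proportional p q) : Proportional q p := by
  obtain ⟨c, hc, rfl⟩ := h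
  exact ⟨c⁻¹, inv_ne_zero hc, by rw [inv_smul_smul₀ hc]⟩

theorem Proportional.trans {p q r : ℂ × ℂ} (h : Proportional p q) (h' : Proportional q r) :
    Proportional p r := by
  obtain ⟨c, hc, rfl⟩ := h
  obtain ⟨d, hd, rfl⟩ := h'
  exact ⟨c * d, mul_ne_zero hc hd, smul_smul _ _ _⟩

theorem Proportional.ne_zero {p q : ℂ × ℂ} (h : Proportional p q) (hq : q ≠ 0) : p ≠ 0 := by
  obtain ⟨c, hc, rfl⟩ := h
  exact smul_ne_zero hc hq

theorem proportional_of_mul_eq {p q : ℂ × ℂ} (hp : p ≠ 0) (hq : q ≠ 0)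
    (h : p.1 * q.2 = p.2 * q.1) : Proportional p q := by
  obtain ⟨a, b⟩ := p
  obtain ⟨c, d⟩ := q
  simp only [ne_eq, Prod.mk_eq_zero, not_and] at *
  by_cases hc : c = 0
  · have hd := hq hc
    have ha : a = 0 := by simpa [hc, hd] using h
    refine ⟨b / d, div_ne_zero (hp ha) hd, ?_⟩
    simp [ha, hc, hd]
  · refine ⟨a / c, div_ne_zero (fun ha => hp ha ?_) hc, ?_⟩
    · simpa [hc, ha] using h
    · simp only [Prod.smul_mk, smul_eq_mul, Prod.mk.injEq]
      field_simp
      exact ⟨trivial, by linear_combination -h⟩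

/-- The map `(x, y) ↦ (-x, y)`. -/
def flip (p : ℂ × ℂ) : ℂ × ℂ := (-p.1, p.2)

/-- The map `(x, y) ↦ (-y, x)`. -/
def turn (p : ℂ × ℂ) : ℂ × ℂ := (-p.2, p.1)

theorem Proportional.flip {p q : ℂ × ℂ} (h : Proportional p q) :
    Proportional (flip p) (flip q) := by
  obtain ⟨c, hc, rfl⟩ := h
  exact ⟨c, hc, by simp [Lattes.flip]⟩

theorem Proportional.turn {p q : ℂ × ℂ} (h : Proportional p q) :
    Proportional (turn p) (turn q) := by
  obtain ⟨c, hc, rfl⟩ := h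
  exact ⟨c, hc, by simp [Lattes.turn]⟩

theorem flip_ne_zero {p : ℂ × ℂ} (hp : p ≠ 0) : flip p ≠ 0 := by
  contrapose! hp
  simpa [flip, Prod.ext_iff] using hp

theorem turn_ne_zero {p : ℂ × ℂ} (hp : p ≠ 0) : turn p ≠ 0 := by
  contrapose! hp
  simpa [turn, Prod.ext_iff, and_comm] using hp

/-- The homogeneous coordinates of the covering, in terms of homogeneous coordinates on the two
factors of `ℙ¹ × ℙ¹`. -/
def biform (p q : ℂ × ℂ) : Fin 3 → ℂ :=
  ![(p.1 * q.1 + p.2 * q.2) ^ 2, (p.1 ^ 2 - p.2 ^ 2) * (q.1 ^ 2 - q.2 ^ 2),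
    (p.1 * q.1 - p.2 * q.2) ^ 2]

theorem biform_comm (p q : ℂ × ℂ) : biform p q = biform q p := by
  funext j
  fin_cases j <;> simp [biform] <;> ring

theorem biform_flip (p q : ℂ × ℂ) : biform (flip p) (flip q) = biform p q := by
  funext j
  fin_cases j <;> simp [biform, flip]

theorem biform_turn (p q : ℂ × ℂ) : biform (turn p) (turn q) = biform p q := by
  funext j
  fin_cases j <;> simp [biform, turn] <;> ring

theorem biform_smul (a b : ℂ) (p q : ℂ × ℂ) :
    biform (a • p) (b • q) = (a * b) ^ 2 • biform p q := by
  funext j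
  fin_cases j <;> simp [biform] <;> ring

/-- The middle coordinate is `A² - C²`, so a zero of `biform` kills `A`, `B` and `C`: the product of
two nonzero linear forms would vanish. -/
theorem biform_ne_zero {p q : ℂ × ℂ} (hp : p ≠ 0) (hq : q ≠ 0) : biform p q ≠ 0 := by
  intro h
  have h0 : p.1 * q.1 + p.2 * q.2 = 0 := by simpa [biform] using congrFun h 0
  have h1 : (p.1 ^ 2 - p.2 ^ 2) * (q.1 ^ 2 - q.2 ^ 2) = 0 := by
    exact congrFun h 1
  have h2 : p.1 * q.1 - p.2 * q.2 = 0 := by simpa [biform] using congrFun h 2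
  have h3 : p.1 * q.1 = 0 := by linear_combination (h0 + h2) / 2
  have h4 : p.2 * q.2 = 0 := by linear_combination (h0 - h2) / 2
  have h5 : (p.1 * q.2 + p.2 * q.1) ^ 2 = 0 := by linear_combination (p.1 * q.1 + p.2 * q.2) * h0 - h1
  rw [sq_eq_zero_iff] at h5
  rcases mul_eq_zero.1 h3 with h | h <;> rcases mul_eq_zero.1 h4 with h' | h'
  · exact hp (Prod.ext h h')
  · rw [h, zero_mul, zero_add] at h5
    rcases mul_eq_zero.1 h5 with h5 | h5
    exacts [hp (Prod.ext h h5), hq (Prod.ext h5 h')]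
  · rw [h, mul_zero, add_zero] at h5
    rcases mul_eq_zero.1 h5 with h5 | h5
    exacts [hp (Prod.ext h5 h'), hq (Prod.ext h h5)]
  · exact hq (Prod.ext h h')

theorem mk_biform_eq {p q p' q' : ℂ × ℂ} (hp : Proportional p p') (hq : Proportional q q')
    (h : biform p q ≠ 0) (h' : biform p' q' ≠ 0) :
    Projectivization.mk ℂ (biform p q) h = Projectivization.mk ℂ (biform p' q') h' := by
  obtain ⟨a, ha, rfl⟩ := hp
  obtain ⟨b, hb, rfl⟩ := hq
  rw [Projectivization.mk_eq_mk_iff']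
  exact ⟨(a * b) ^ 2, (biform_smul a b p' q').symm⟩

/-- Unique factorization: a binary quadratic form determines its two linear factors up to order and
scalars. -/
theorem proportional_of_forms_eq {p q p' q' : ℂ × ℂ} (hp : p ≠ 0) (hq : q ≠ 0) (hp' : p' ≠ 0)
    (hq' : q' ≠ 0) {c : ℂ}
    (h0 : p.1 * q.1 + p.2 * q.2 = c * (p'.1 * q'.1 + p'.2 * q'.2))
    (h1 : p.1 * q.1 - p.2 * q.2 = c * (p'.1 * q'.1 - p'.2 * q'.2))
    (h2 : p.1 * q.2 + p.2 * q.1 = c * (p'.1 * q'.2 + p'.2 * q'.1)) :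
    (Proportional p p' ∧ Proportional q q') ∨ (Proportional p q' ∧ Proportional q p') := by
  have key : ∀ {p q : ℂ × ℂ}, p ≠ 0 → q ≠ 0 →
      p.1 * q.1 + p.2 * q.2 = c * (p'.1 * q'.1 + p'.2 * q'.2) →
      p.1 * q.1 - p.2 * q.2 = c * (p'.1 * q'.1 - p'.2 * q'.2) →
      p.1 * q.2 + p.2 * q.1 = c * (p'.1 * q'.2 + p'.2 * q'.1) →
      p.1 * p'.2 - p.2 * p'.1 = 0 → Proportional p p' ∧ Proportional q q' := by
    intro p q hp hq h0 h1 h2 h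
    have hpp := proportional_of_mul_eq hp hp' (sub_eq_zero.1 h)
    refine ⟨hpp, proportional_of_mul_eq hq hq' ?_⟩
    obtain ⟨a, ha, rfl⟩ := hpp
    simp only [Prod.smul_fst, Prod.smul_snd, smul_eq_mul] at h0 h1 h2
    have e1 : p'.1 * (a * q.1 - c * q'.1) = 0 := by linear_combination (h0 + h1) / 2
    have e2 : p'.2 * (a * q.2 - c * q'.2) = 0 := by linear_combination (h0 - h1) / 2
    have e3 : p'.1 * (a * q.2 - c * q'.2) + p'.2 * (a * q.1 - c * q'.1) = 0 := by
      linear_combination h2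
    have e4 : a * q.1 - c * q'.1 = 0 ∧ a * q.2 - c * q'.2 = 0 := by
      rcases mul_eq_zero.1 e1 with h | h <;> rcases mul_eq_zero.1 e2 with h' | h'
      · exact absurd (Prod.ext h h') hp'
      · rw [h, h', zero_mul, zero_add] at e3
        exact ⟨(mul_eq_zero.1 e3).resolve_left fun h'' => hp' (Prod.ext h h''), h'⟩
      · rw [h, h', zero_mul, add_zero] at e3
        exact ⟨h, (mul_eq_zero.1 e3).resolve_left fun h'' => hp' (Prod.ext h'' h')⟩
      · exact ⟨h, h'⟩
    refine mul_left_cancel₀ ha ?_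
    linear_combination q'.2 * e4.1 - q'.1 * e4.2
  -- Evaluation of the product of forms attached to `p` and `q` at the root of the factor `p'`.
  have hmul : (p.1 * p'.2 - p.2 * p'.1) * (q.1 * p'.2 - q.2 * p'.1) = 0 := by
    linear_combination (h0 + h1) / 2 * p'.2 ^ 2 - h2 * p'.1 * p'.2 + (h0 - h1) / 2 * p'.1 ^ 2
  rcases mul_eq_zero.1 hmul with h | h
  · exact .inl (key hp hq h0 h1 h2 h)
  · exact .inr (key hq hp (by linear_combination h0) (by linear_combination h1)
      (by linear_combination h2) h).symm

/-- `biform` determines `A²`, `B²`, `C²` up to a common factor `m²`, hence `A`, `B`, `C` up to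
signs. Modulo a common sign four patterns remain: `flip` negates `C`, `turn` negates `B` and `C`,
and their composite negates `B`. -/
theorem proportional_of_biform_eq {p q p' q' : ℂ × ℂ} (hp : p ≠ 0) (hq : q ≠ 0) (hp' : p' ≠ 0)
    (hq' : q' ≠ 0) {c : ℂ} (h : biform p q = c • biform p' q') :
    ∃ φ ∈ ({id, flip, turn, flip ∘ turn} : Set (ℂ × ℂ → ℂ × ℂ)),
      (Proportional p (φ p') ∧ Proportional q (φ q')) ∨
      (Proportional p (φ q') ∧ Proportional q (φ p')) := by
  obtain ⟨m, rfl⟩ := IsAlgClosed.exists_pow_nat_eq c two_pos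
  have h0 : (p.1 * q.1 + p.2 * q.2) ^ 2 = (m * (p'.1 * q'.1 + p'.2 * q'.2)) ^ 2 := by
    rw [mul_pow]
    exact congrFun h 0
  have h1 : (p.1 * q.1 - p.2 * q.2) ^ 2 = (m * (p'.1 * q'.1 - p'.2 * q'.2)) ^ 2 := by
    rw [mul_pow]
    exact congrFun h 2
  have h2 : (p.1 * q.2 + p.2 * q.1) ^ 2 = (m * (p'.1 * q'.2 + p'.2 * q'.1)) ^ 2 := by
    have h3 : (p.1 ^ 2 - p.2 ^ 2) * (q.1 ^ 2 - q.2 ^ 2) =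
      m ^ 2 * ((p'.1 ^ 2 - p'.2 ^ 2) * (q'.1 ^ 2 - q'.2 ^ 2)) := congrFun h 1
    linear_combination h0 - h3
  have core : ∀ n : ℂ, p.1 * q.1 + p.2 * q.2 = n * (p'.1 * q'.1 + p'.2 * q'.2) →
      (p.1 * q.1 - p.2 * q.2 = n * (p'.1 * q'.1 - p'.2 * q'.2) ∨
        p.1 * q.1 - p.2 * q.2 = -(n * (p'.1 * q'.1 - p'.2 * q'.2))) →
      (p.1 * q.2 + p.2 * q.1 = n * (p'.1 * q'.2 + p'.2 * q'.1) ∨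
        p.1 * q.2 + p.2 * q.1 = -(n * (p'.1 * q'.2 + p'.2 * q'.1))) →
      ∃ φ ∈ ({id, flip, turn, flip ∘ turn} : Set (ℂ × ℂ → ℂ × ℂ)),
        (Proportional p (φ p') ∧ Proportional q (φ q')) ∨
        (Proportional p (φ q') ∧ Proportional q (φ p')) := by
    rintro n hA (hB | hB) (hC | hC)
    · exact ⟨id, by simp, proportional_of_forms_eq hp hq hp' hq' hA hB hC⟩
    · refine ⟨flip, by simp, proportional_of_forms_eq hp hq (flip_ne_zero hp') (flip_ne_zero hq')
        (c := n) ?_ ?_ ?_⟩ <;> simp only [flip]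
      · linear_combination hA
      · linear_combination hB
      · linear_combination hC
    · refine ⟨flip ∘ turn, by simp, proportional_of_forms_eq hp hq
        (flip_ne_zero (turn_ne_zero hp')) (flip_ne_zero (turn_ne_zero hq'))
        (c := n) ?_ ?_ ?_⟩ <;> simp only [Function.comp_apply, flip, turn]
      · linear_combination hA
      · linear_combination hB
      · linear_combination hC
    · refine ⟨turn, by simp, proportional_of_forms_eq hp hq (turn_ne_zero hp') (turn_ne_zero hq')
        (c := n) ?_ ?_ ?_⟩ <;> simp only [turn]
      · linear_combination hA
      · linear_combination hB
      · linear_combination hC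
  rw [sq_eq_sq_iff_eq_or_eq_neg] at h0 h1 h2
  rcases h0 with h0 | h0
  · exact core m h0 h1 h2
  · refine core (-m) (by linear_combination h0) ?_ ?_
    · simpa only [neg_mul, neg_neg] using h1.symm
    · simpa only [neg_mul, neg_neg] using h2.symm

/-- Choose square roots `A`, `B`, `C` of the prescribed squares, then factor the corresponding
binary quadratic form. -/
theorem exists_biform_eq {w : Fin 3 → ℂ} (hw : w ≠ 0) :
    ∃ p q : ℂ × ℂ, p ≠ 0 ∧ q ≠ 0 ∧ biform p q = w := by
  obtain ⟨A, hA⟩ := IsAlgClosed.exists_pow_nat_eq (w 0) two_pos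
  obtain ⟨B, hB⟩ := IsAlgClosed.exists_pow_nat_eq (w 2) two_pos
  obtain ⟨C, hC⟩ := IsAlgClosed.exists_pow_nat_eq (w 0 - w 1) two_pos
  suffices h : ∃ p q : ℂ × ℂ, p.1 * q.1 + p.2 * q.2 = A ∧ p.1 * q.1 - p.2 * q.2 = B ∧
      p.1 * q.2 + p.2 * q.1 = C by
    obtain ⟨p, q, h0, h1, h2⟩ := h
    have e : biform p q = w := by
      funext j
      fin_cases j
      · simp [biform, h0, hA]
      · have : (p.1 ^ 2 - p.2 ^ 2) * (q.1 ^ 2 - q.2 ^ 2) = A ^ 2 - C ^ 2 := by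
          rw [← h0, ← h2]
          ring
        simp [biform, this, hA, hC]
      · simp [biform, h1, hB]
    refine ⟨p, q, ?_, ?_, e⟩
    · rintro rfl
      refine hw (e ▸ ?_)
      funext j
      fin_cases j <;> simp [biform]
    · rintro rfl
      refine hw (e ▸ ?_)
      funext j
      fin_cases j <;> simp [biform]
  by_cases hAB : A = B
  · refine ⟨(1, 0), (A, C), ?_⟩
    simp [hAB]
  · have hg : A - B ≠ 0 := sub_ne_zero.2 hAB
    -- Normalizing `p.2 = 1` forces `q.2 = (A - B)/2`; then `p.1 * q.2` and `q.1` are the roots of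
    -- `X² - C X + (A² - B²)/4`, whose discriminant is `d²`.
    obtain ⟨d, hd⟩ := IsAlgClosed.exists_pow_nat_eq (C ^ 2 - (A - B) * (A + B)) two_pos
    refine ⟨((C + d) / (A - B), 1), ((C - d) / 2, (A - B) / 2), ?_, ?_, ?_⟩
    · field_simp
      linear_combination -hd
    · field_simp
      linear_combination -hd
    · field_simp
      ring

/-! ### The normalized function as a map to `ℙ¹`. -/

open Classical in
/-- Homogeneous coordinates of the normalized Weierstrass function. -/
def ellPair (z : ℂ) : ℂ × ℂ := if z ∈ gaussInt then (1, 0) else (ell z, 1)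

theorem ellPair_of_mem {z : ℂ} (h : z ∈ gaussInt) : ellPair z = (1, 0) := if_pos h

theorem ellPair_of_notMem {z : ℂ} (h : z ∉ gaussInt) : ellPair z = (ell z, 1) := if_neg h

theorem ellPair_ne_zero (z : ℂ) : ellPair z ≠ 0 := by
  unfold ellPair
  split_ifs <;> simp [Prod.ext_iff]

theorem ellPair_sub_mem {z w : ℂ} (h : z - w ∈ gaussInt) : ellPair z = ellPair w := by
  have h' : z ∈ gaussInt ↔ w ∈ gaussInt :=
    ⟨fun hz => by simpa using sub_mem hz h, fun hw => by simpa using add_mem h hw⟩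
  by_cases hw : w ∈ gaussInt
  · rw [ellPair_of_mem hw, ellPair_of_mem (h'.2 hw)]
  · rw [ellPair_of_notMem hw, ellPair_of_notMem (h'.not.2 hw), ell_sub_mem h]

theorem ellPair_neg (z : ℂ) : ellPair (-z) = ellPair z := by
  by_cases hz : z ∈ gaussInt
  · rw [ellPair_of_mem hz, ellPair_of_mem (neg_mem hz)]
  · rw [ellPair_of_notMem hz, ellPair_of_notMem (by rwa [neg_mem_iff]), ell_neg]

theorem ellPair_I_mul (z : ℂ) : Proportional (ellPair (Complex.I * z)) (flip (ellPair z)) := by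
  by_cases hz : z ∈ gaussInt
  · rw [ellPair_of_mem hz, ellPair_of_mem (I_mul_mem_gaussInt_iff.2 hz)]
    exact ⟨-1, by simp, by simp [flip]⟩
  · rw [ellPair_of_notMem hz, ellPair_of_notMem (by rwa [I_mul_mem_gaussInt_iff]), ell_I_mul]
    exact .refl _

theorem ell_eq_zero_of_mem {z : ℂ} (h : z + tau ∈ gaussInt) : ell z = 0 := by
  rw [← ell_tau, ← ell_neg tau]
  exact ell_sub_mem (by rwa [sub_neg_eq_add])

theorem notMem_of_add_tau_mem {z : ℂ} (h : z + tau ∈ gaussInt) : z ∉ gaussInt := fun h' =>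
  tau_notMem (by simpa using sub_mem h h')

theorem proportional_ellPair {z : ℂ} (h : z + tau ∉ gaussInt) :
    Proportional (1, -ell (z + tau)) (ellPair z) := by
  by_cases hz : z ∈ gaussInt
  · have h2 : ell (z + tau) = 0 := ell_eq_zero_of_mem (by
      rw [add_assoc, ← two_mul, add_two_mul_tau_mem_iff]
      exact hz)
    rw [ellPair_of_mem hz, h2, neg_zero]
    exact .refl _
  · have h1 := ell_mul_ell_add_tau hz h
    rw [ellPair_of_notMem hz]
    refine ⟨-ell (z + tau), fun h0 => ?_, ?_⟩
    · rw [neg_eq_zero.1 h0] at h1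
      simp at h1
    · ext
      · simp only [Prod.smul_mk, smul_eq_mul]
        linear_combination h1
      · simp

theorem ellPair_add_tau (z : ℂ) : Proportional (ellPair (z + tau)) (turn (ellPair z)) := by
  by_cases h : z + tau ∈ gaussInt
  · rw [ellPair_of_mem h, ellPair_of_notMem (notMem_of_add_tau_mem h), ell_eq_zero_of_mem h]
    exact ⟨-1, by simp, by simp [turn]⟩
  · rw [ellPair_of_notMem h]
    refine .trans ?_ (proportional_ellPair h).turn
    simp only [turn, neg_neg]
    exact .refl _

theorem ellPair_proportional_iff {u v : ℂ} :
    Proportional (ellPair u) (ellPair v) ↔ u - v ∈ gaussInt ∨ u + v ∈ gaussInt := by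
  constructor
  · rintro ⟨c, hc, h⟩
    by_cases hu : u ∈ gaussInt <;> by_cases hv : v ∈ gaussInt
    · exact .inl (sub_mem hu hv)
    · rw [ellPair_of_mem hu, ellPair_of_notMem hv] at h
      exact absurd (by simpa using (congrArg Prod.snd h).symm) hc
    · rw [ellPair_of_notMem hu, ellPair_of_mem hv] at h
      exact absurd (congrArg Prod.snd h) (by simp)
    · rw [ellPair_of_notMem hu, ellPair_of_notMem hv] at h
      obtain rfl : 1 = c := by simpa using congrArg Prod.snd h
      exact (ell_eq_iff hu hv).1 (by simpa using h)
  · rintro (h | h)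
    · exact .of_eq (ellPair_sub_mem h)
    · rw [← ellPair_neg v]
      exact .of_eq (ellPair_sub_mem (by rwa [sub_neg_eq_add]))

theorem exists_ellPair_proportional {p : ℂ × ℂ} (hp : p ≠ 0) :
    ∃ z, Proportional p (ellPair z) := by
  by_cases h : p.2 = 0
  · refine ⟨0, proportional_of_mul_eq hp (ellPair_ne_zero _) ?_⟩
    simp [h, ellPair_of_mem (zero_mem gaussInt)]
  · obtain ⟨z, hz, he⟩ := exists_ell_eq (p.1 / p.2)
    refine ⟨z, proportional_of_mul_eq hp (ellPair_ne_zero _) ?_⟩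
    rw [ellPair_of_notMem hz, he]
    field_simp

/-- At a pole, the relation `ell z = -1 / ell (z + tau)` supplies the second chart of `ℙ¹`. -/
theorem exists_differentiable_ellPair (z₀ : ℂ) : ∃ k : ℂ → ℂ × ℂ,
    ∀ᶠ z in 𝓝 z₀, DifferentiableAt ℂ k z ∧ Proportional (k z) (ellPair z) := by
  by_cases hz : z₀ ∈ gaussInt
  · refine ⟨fun z => (1, -ell (z + tau)), ?_⟩
    have h1 : z₀ + tau ∉ gaussInt := fun h => tau_notMem (by simpa using sub_mem h hz)
    have h2 : ContinuousAt (fun z => z + tau) z₀ := by fun_prop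
    filter_upwards [h2.eventually_mem (gaussPair.isOpen_compl_lattice.mem_nhds h1)] with z h
    refine ⟨(differentiableAt_const _).prodMk ?_, proportional_ellPair h⟩
    exact ((differentiableAt_ell h).comp z (by fun_prop : DifferentiableAt ℂ (· + tau) z)).neg
  · refine ⟨fun z => (ell z, 1), ?_⟩
    filter_upwards [gaussPair.isOpen_compl_lattice.mem_nhds hz] with z h
    exact ⟨(differentiableAt_ell h).prodMk (differentiableAt_const _),
      .of_eq (ellPair_of_notMem h).symm⟩

/-- The map of `ℙ¹` induced by the multiplication by `1 + i`. -/
def mulOneAddI (p : ℂ × ℂ) : ℂ × ℂ := (p.1 ^ 2 - p.2 ^ 2, 2 * Complex.I * p.1 * p.2)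

theorem Proportional.mulOneAddI {p q : ℂ × ℂ} (h : Proportional p q) :
    Proportional (mulOneAddI p) (mulOneAddI q) := by
  obtain ⟨c, hc, rfl⟩ := h
  refine ⟨c ^ 2, by simp [hc], ?_⟩
  ext <;> simp [Lattes.mulOneAddI] <;> ring

theorem mulOneAddI_ne_zero {p : ℂ × ℂ} (hp : p ≠ 0) : mulOneAddI p ≠ 0 := by
  intro h
  have h1 : p.1 ^ 2 - p.2 ^ 2 = 0 := congrArg Prod.fst h
  have h2 : 2 * Complex.I * p.1 * p.2 = 0 := congrArg Prod.snd h
  simp only [mul_eq_zero, OfNat.ofNat_ne_zero, Complex.I_ne_zero, false_or] at h2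
  apply hp
  rcases h2 with h2 | h2 <;> simp [h2] at h1 <;> exact Prod.ext (by simp [*]) (by simp [*])

theorem ellPair_one_add_I_mul (z : ℂ) :
    Proportional (ellPair ((1 + Complex.I) * z)) (mulOneAddI (ellPair z)) := by
  refine proportional_of_mul_eq (ellPair_ne_zero _) (mulOneAddI_ne_zero (ellPair_ne_zero _)) ?_
  by_cases hz : z ∈ gaussInt
  · rw [ellPair_of_mem hz, ellPair_of_mem
      (mul_mem_gaussInt (add_mem one_mem_gaussInt I_mem_gaussInt) hz)]
    simp [mulOneAddI]
  by_cases h : (1 + Complex.I) * z ∈ gaussInt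
  · have hI : Complex.I * z ∉ gaussInt := by rwa [I_mul_mem_gaussInt_iff]
    have h0 : ell z = ell (Complex.I * z) := (ell_eq_iff hz hI).2 (.inr (by convert h using 1; ring))
    rw [ell_I_mul, self_eq_neg] at h0
    rw [ellPair_of_mem h, ellPair_of_notMem hz, h0]
    simp [mulOneAddI]
  · rw [ellPair_of_notMem h, ellPair_of_notMem hz]
    simp only [mulOneAddI]
    linear_combination ell_one_add_I_mul hz h

theorem ellPair_two_mul (z : ℂ) : Proportional (ellPair (2 * z))
    (((ellPair z).1 ^ 2 + (ellPair z).2 ^ 2) ^ 2,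
      4 * (ellPair z).1 * (ellPair z).2 * ((ellPair z).1 ^ 2 - (ellPair z).2 ^ 2)) := by
  -- Duplication reduces to known maps since `2 = -i (1 + i)²`.
  have e : 2 * z = -(Complex.I * ((1 + Complex.I) * ((1 + Complex.I) * z))) := by
    linear_combination (2 * z + Complex.I * z) * Complex.I_mul_I
  rw [e, ellPair_neg]
  refine (ellPair_I_mul _).trans (((ellPair_one_add_I_mul _).trans
    (ellPair_one_add_I_mul _).mulOneAddI).flip.trans ⟨-1, by simp, ?_⟩)
  ext
  · simp only [flip, mulOneAddI, Prod.smul_mk, smul_eq_mul, mul_pow, Complex.I_sq]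
    ring
  · simp only [flip, mulOneAddI, Prod.smul_mk, smul_eq_mul]
    linear_combination (4 * ((ellPair z).1 ^ 2 - (ellPair z).2 ^ 2) *
      (ellPair z).1 * (ellPair z).2) * Complex.I_mul_I

/-! ### The covering and the three semiconjugacies. -/

/-- The composition of the covering of `ℙ²` with the projection `ℂ² → A_i × A_i`. -/
def coverLift (v : Fin 2 → ℂ) : ProjSpace 2 :=
  Projectivization.mk ℂ (biform (ellPair (v 0)) (ellPair (v 1)))
    (biform_ne_zero (ellPair_ne_zero _) (ellPair_ne_zero _))

theorem coverLift_eq {v : Fin 2 → ℂ} {p q : ℂ × ℂ} (hp : Proportional (ellPair (v 0)) p)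
    (hq : Proportional (ellPair (v 1)) q) : coverLift v = Projectivization.mk ℂ (biform p q)
      (biform_ne_zero (hp.symm.ne_zero (ellPair_ne_zero _))
        (hq.symm.ne_zero (ellPair_ne_zero _))) :=
  mk_biform_eq hp hq _ _

/-- The covering `A_i × A_i → ℙ²`. -/
def cover (t : Torus gaussLattice) : ProjSpace 2 :=
  coverLift (Submodule.Quotient.mk_surjective gaussLattice t).choose

theorem toTorus_eq_iff {v w : Fin 2 → ℂ} : toTorus gaussLattice v = toTorus gaussLattice w ↔
    v 0 - w 0 ∈ gaussInt ∧ v 1 - w 1 ∈ gaussInt := by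
  rw [toTorus, toTorus, Submodule.Quotient.eq, mem_gaussLattice, Fin.forall_fin_two]
  rfl

theorem cover_toTorus (v : Fin 2 → ℂ) : cover (toTorus gaussLattice v) = coverLift v := by
  have h := (Submodule.Quotient.mk_surjective gaussLattice (toTorus gaussLattice v)).choose_spec
  obtain ⟨h0, h1⟩ := toTorus_eq_iff.1 h
  exact coverLift_eq (.of_eq (ellPair_sub_mem h0)) (.of_eq (ellPair_sub_mem h1))

theorem cover_surjective : Function.Surjective cover := by
  intro x
  induction x using Projectivization.ind with
  | h w hw =>
    obtain ⟨p, q, hp, hq, rfl⟩ := exists_biform_eq hw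
    obtain ⟨z₀, h0⟩ := exists_ellPair_proportional hp
    obtain ⟨z₁, h1⟩ := exists_ellPair_proportional hq
    exact ⟨toTorus gaussLattice ![z₀, z₁],
      (cover_toTorus _).trans (coverLift_eq (v := ![z₀, z₁]) h0.symm h1.symm)⟩

theorem cover_holomorphic : IsHolomorphicToProj gaussLattice cover := by
  intro v
  obtain ⟨k, hk⟩ := exists_differentiable_ellPair (v 0)
  obtain ⟨l, hl⟩ := exists_differentiable_ellPair (v 1)
  refine ⟨fun w => biform (k (w 0)) (l (w 1)), ?_⟩
  filter_upwards [(continuous_apply (0 : Fin 2)).continuousAt.eventually hk,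
    (continuous_apply (1 : Fin 2)).continuousAt.eventually hl] with w hkw hlw
  refine ⟨?_, biform_ne_zero (hkw.2.ne_zero (ellPair_ne_zero _))
    (hlw.2.ne_zero (ellPair_ne_zero _)), ?_⟩
  · have dk : DifferentiableAt ℂ (fun w : Fin 2 → ℂ => k (w 0)) w :=
      DifferentiableAt.comp w (g := k) hkw.1 (by fun_prop)
    have dl : DifferentiableAt ℂ (fun w : Fin 2 → ℂ => l (w 1)) w :=
      DifferentiableAt.comp w (g := l) hlw.1 (by fun_prop)
    have dk1 := dk.fst
    have dk2 := dk.snd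
    have dl1 := dl.fst
    have dl2 := dl.snd
    rw [differentiableAt_pi]
    intro j
    fin_cases j <;> simp only [biform, Fin.zero_eta, Fin.mk_one, Fin.reduceFinMk, Matrix.cons_val]
      <;> fun_prop
  · rw [cover_toTorus]
    exact coverLift_eq hkw.2.symm hlw.2.symm

theorem cover_semiconj_D₁ :
    Function.Semiconj cover (torusMap gaussLattice D₁ D₁_mem) f₁ := by
  intro t
  obtain ⟨v, rfl⟩ := Submodule.Quotient.mk_surjective _ t
  change cover (torusMap gaussLattice D₁ D₁_mem (toTorus gaussLattice v)) =
    f₁ (cover (toTorus gaussLattice v))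
  rw [torusMap_toTorus, cover_toTorus, cover_toTorus, D₁_eq]
  have h0 : (!![1 + Complex.I, 0; 0, 1 + Complex.I] *ᵥ v) 0 = (1 + Complex.I) * v 0 := by
    simp [Matrix.mulVec, dotProduct]
  have h1 : (!![1 + Complex.I, 0; 0, 1 + Complex.I] *ᵥ v) 1 = (1 + Complex.I) * v 1 := by
    simp [Matrix.mulVec, dotProduct]
  rw [coverLift_eq (by rw [h0]; exact ellPair_one_add_I_mul _)
    (by rw [h1]; exact ellPair_one_add_I_mul _), coverLift, f₁, quadraticMap_mk,
    Projectivization.mk_eq_mk_iff']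
  refine ⟨1, ?_⟩
  generalize ellPair (v 0) = p
  generalize ellPair (v 1) = q
  have hI : 2 * Complex.I * p.1 * p.2 * (2 * Complex.I * q.1 * q.2) =
      -(4 * (p.1 * p.2 * q.1 * q.2)) := by
    linear_combination (4 * p.1 * p.2 * q.1 * q.2) * Complex.I_mul_I
  funext j
  fin_cases j
  · simp only [F₁, biform, mulOneAddI, hI, Fin.zero_eta, Matrix.cons_val, Pi.smul_apply, one_smul]
    ring
  · simp only [F₁, biform, mulOneAddI, mul_pow, Complex.I_sq, Fin.mk_one, Matrix.cons_val,
      Pi.smul_apply, one_smul]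
    ring
  · simp only [F₁, biform, mulOneAddI, hI, Fin.reduceFinMk, Matrix.cons_val, Pi.smul_apply,
      one_smul]
    ring

/-- `biform` is symmetric, so the image depends only on the sum and product of `ell (u ± v)`. The
cases where one of `u`, `v`, `u ± v` is a period fall outside the addition theorem and are treated
separately. -/
theorem coverLift_add_sub (u v : ℂ) :
    coverLift ![u + v, u - v] = f₂ (coverLift ![u, v]) := by
  by_cases hu : u ∈ gaussInt
  · rw [coverLift_eq (v := ![u + v, u - v]) (p := ellPair v) (q := ellPair v)
      (.of_eq (ellPair_sub_mem (by simpa using hu)))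
      (ellPair_proportional_iff.2 (.inr (by simpa using hu))),
      coverLift, f₂, quadraticMap_mk, Projectivization.mk_eq_mk_iff']
    refine ⟨1, ?_⟩
    simp only [Matrix.cons_val_zero, Matrix.cons_val_one, ellPair_of_mem hu]
    funext j
    fin_cases j <;> simp [F₂, biform] <;> ring
  by_cases hv : v ∈ gaussInt
  · rw [coverLift_eq (v := ![u + v, u - v]) (p := ellPair u) (q := ellPair u)
      (.of_eq (ellPair_sub_mem (by simpa using hv)))
      (.of_eq (ellPair_sub_mem (by simpa using hv))),
      coverLift, f₂, quadraticMap_mk, Projectivization.mk_eq_mk_iff']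
    refine ⟨1, ?_⟩
    simp only [Matrix.cons_val_zero, Matrix.cons_val_one, ellPair_of_mem hv]
    funext j
    fin_cases j <;> simp [F₂, biform] <;> ring
  by_cases hadd : u + v ∈ gaussInt
  · have e : ellPair v = ellPair u := by
      rw [← ellPair_neg]
      exact ellPair_sub_mem (by convert neg_mem hadd using 1; ring)
    have e2 : ellPair (u - v) = ellPair (2 * u) :=
      ellPair_sub_mem (by convert neg_mem hadd using 1; ring)
    rw [coverLift_eq (v := ![u + v, u - v]) (.of_eq (ellPair_of_mem hadd))
      ((Proportional.of_eq e2).trans (ellPair_two_mul u)),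
      coverLift, f₂, quadraticMap_mk, Projectivization.mk_eq_mk_iff']
    refine ⟨1, ?_⟩
    simp only [Matrix.cons_val_zero, Matrix.cons_val_one, e]
    funext j
    fin_cases j <;> simp [F₂, biform] <;> ring
  by_cases hsub : u - v ∈ gaussInt
  · have e : ellPair u = ellPair v := ellPair_sub_mem hsub
    have e2 : ellPair (u + v) = ellPair (2 * v) :=
      ellPair_sub_mem (by convert hsub using 1; ring)
    rw [coverLift_eq (v := ![u + v, u - v]) ((Proportional.of_eq e2).trans (ellPair_two_mul v))
      (.of_eq (ellPair_of_mem hsub)),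
      coverLift, f₂, quadraticMap_mk, Projectivization.mk_eq_mk_iff']
    refine ⟨1, ?_⟩
    simp only [Matrix.cons_val_zero, Matrix.cons_val_one, e]
    funext j
    fin_cases j <;> simp [F₂, biform] <;> ring
  · have h1 := ell_add_add_ell_sub hu hv hadd hsub
    have h2 := ell_add_mul_ell_sub hu hv hadd hsub
    symm
    rw [coverLift, coverLift, f₂, quadraticMap_mk, Projectivization.mk_eq_mk_iff']
    -- The sum and product formulas have denominator `(ell u - ell v)²`, and the coordinates are
    -- quadratic in the sum and product.
    refine ⟨(ell u - ell v) ^ 4, ?_⟩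
    simp only [Matrix.cons_val_zero, Matrix.cons_val_one, ellPair_of_notMem hu,
      ellPair_of_notMem hv, ellPair_of_notMem hadd, ellPair_of_notMem hsub]
    generalize ell u = x at *
    generalize ell v = y at *
    generalize ell (u + v) = a at *
    generalize ell (u - v) = b at *
    funext j
    fin_cases j
    · simp [F₂, biform]
      linear_combination (a * b * (x - y) ^ 2 + (x * y + 1) ^ 2 + 2 * (x - y) ^ 2) * h2
    · simp [F₂, biform]
      linear_combination (a * b * (x - y) ^ 2 + (x * y + 1) ^ 2 + 2 * (x - y) ^ 2) * h2
        - ((a + b) * (x - y) ^ 2 + 2 * (x + y) * (x * y - 1)) * h1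
    · simp [F₂, biform]
      linear_combination (a * b * (x - y) ^ 2 + (x * y + 1) ^ 2 - 2 * (x - y) ^ 2) * h2

theorem cover_semiconj_D₂ :
    Function.Semiconj cover (torusMap gaussLattice D₂ D₂_mem) f₂ := by
  intro t
  obtain ⟨v, rfl⟩ := Submodule.Quotient.mk_surjective _ t
  change cover (torusMap gaussLattice D₂ D₂_mem (toTorus gaussLattice v)) =
    f₂ (cover (toTorus gaussLattice v))
  rw [torusMap_toTorus, cover_toTorus, cover_toTorus, D₂_eq]
  convert coverLift_add_sub (v 0) (v 1) using 2
  · funext j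
    fin_cases j <;> simp [Matrix.mulVec, dotProduct, sub_eq_add_neg]
  · congr 1
    funext j
    fin_cases j <;> rfl

/-- `D₃` is `D₂` followed by multiplication of the second coordinate by `i`. Flipping only one
factor exchanges the outer coordinates of `biform`, and `f₃` is `f₂` with its outer components
exchanged. -/
theorem cover_semiconj_D₃ :
    Function.Semiconj cover (torusMap gaussLattice D₃ D₃_mem) f₃ := by
  intro t
  have h := cover_semiconj_D₂ t
  obtain ⟨v, rfl⟩ := Submodule.Quotient.mk_surjective _ t
  change cover (torusMap gaussLattice D₂ D₂_mem (toTorus gaussLattice v)) =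
    f₂ (cover (toTorus gaussLattice v)) at h
  change cover (torusMap gaussLattice D₃ D₃_mem (toTorus gaussLattice v)) =
    f₃ (cover (toTorus gaussLattice v))
  rw [torusMap_toTorus, cover_toTorus, cover_toTorus] at h ⊢
  have h0 : (D₃ *ᵥ v) 0 = (D₂ *ᵥ v) 0 := by
    simp [D₂_eq, D₃_eq, Matrix.mulVec, dotProduct]
  have h1 : (D₃ *ᵥ v) 1 = Complex.I * (D₂ *ᵥ v) 1 := by
    simp [D₂_eq, D₃_eq, Matrix.mulVec, dotProduct]
    ring
  rw [coverLift_eq (.of_eq (by rw [h0])) (by rw [h1]; exact ellPair_I_mul _)]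
  rw [coverLift, coverLift, f₂, quadraticMap_mk, Projectivization.mk_eq_mk_iff'] at h
  rw [coverLift, f₃, quadraticMap_mk, Projectivization.mk_eq_mk_iff']
  obtain ⟨c, hc⟩ := h
  refine ⟨c, ?_⟩
  funext j
  fin_cases j
  · have := congrFun hc 2
    simp [F₂, F₃, biform, flip] at this ⊢
    linear_combination this
  · have := congrFun hc 1
    simp [F₂, F₃, biform, flip] at this ⊢
    linear_combination this
  · have := congrFun hc 0
    simp [F₂, F₃, biform, flip] at this ⊢
    linear_combination this

/-! ### The covering group: normal form, finiteness, invariance of the covering. -/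

theorem fourth_root_cases {a : ℂ} (h : a ^ 4 = 1) :
    a = 1 ∨ a = -1 ∨ a = Complex.I ∨ a = -Complex.I := by
  have h1 : (a - 1) * ((a + 1) * ((a - Complex.I) * (a + Complex.I))) = 0 := by
    linear_combination h - (a ^ 2 - 1) * Complex.I_mul_I
  simpa [sub_eq_zero, add_eq_zero_iff_eq_neg] using h1

theorem sq_cases_of_pow_four {a : ℂ} (h : a ^ 4 = 1) : a ^ 2 = 1 ∨ a ^ 2 = -1 := by
  rcases fourth_root_cases h with rfl | rfl | rfl | rfl <;> simp

/-- The monomial matrices that make up `G(4, 2, 2)`. -/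
def IsMonomial (M : Matrix (Fin 2) (Fin 2) ℂ) : Prop :=
  ∃ a b : ℂ, a ^ 4 = 1 ∧ b ^ 4 = 1 ∧ a ^ 2 = b ^ 2 ∧ (M = !![a, 0; 0, b] ∨ M = !![0, a; b, 0])

theorem isMonomial_one : IsMonomial 1 :=
  ⟨1, 1, by simp, by simp, rfl, .inl Matrix.one_fin_two⟩

theorem IsMonomial.mul {M N : Matrix (Fin 2) (Fin 2) ℂ} (hM : IsMonomial M) (hN : IsMonomial N) :
    IsMonomial (M * N) := by
  obtain ⟨a, b, ha, hb, hab, hM⟩ := hM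
  obtain ⟨c, d, hc, hd, hcd, hN⟩ := hN
  rcases hM with rfl | rfl <;> rcases hN with rfl | rfl
  · exact ⟨a * c, b * d, by simp [mul_pow, *], by simp [mul_pow, *], by simp [mul_pow, *],
      .inl (by simp)⟩
  · exact ⟨a * c, b * d, by simp [mul_pow, *], by simp [mul_pow, *], by simp [mul_pow, *],
      .inr (by simp)⟩
  · exact ⟨a * d, b * c, by simp [mul_pow, *], by simp [mul_pow, *], by simp [mul_pow, *],
      .inr (by simp)⟩
  · exact ⟨a * d, b * c, by simp [mul_pow, *], by simp [mul_pow, *], by simp [mul_pow, *],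
      .inl (by simp)⟩

theorem IsMonomial.exists_mul_eq_one {M : Matrix (Fin 2) (Fin 2) ℂ} (hM : IsMonomial M) :
    ∃ N, IsMonomial N ∧ M * N = 1 := by
  obtain ⟨a, b, ha, hb, hab, hM⟩ := hM
  have ha' : a * a ^ 3 = 1 := by rw [← pow_succ', ha]
  have hb' : b * b ^ 3 = 1 := by rw [← pow_succ', hb]
  have h3 : (a ^ 3) ^ 2 = (b ^ 3) ^ 2 := by rw [← pow_mul, ← pow_mul, mul_comm, pow_mul, pow_mul, hab]
  have ha3 : (a ^ 3) ^ 4 = 1 := by rw [← pow_mul, mul_comm, pow_mul, ha, one_pow]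
  have hb3 : (b ^ 3) ^ 4 = 1 := by rw [← pow_mul, mul_comm, pow_mul, hb, one_pow]
  rcases hM with rfl | rfl
  · exact ⟨!![a ^ 3, 0; 0, b ^ 3], ⟨_, _, ha3, hb3, h3, .inl rfl⟩,
      by simp [ha', hb', Matrix.one_fin_two]⟩
  · exact ⟨!![0, b ^ 3; a ^ 3, 0], ⟨_, _, hb3, ha3, h3.symm, .inr rfl⟩,
      by simp [ha', hb', Matrix.one_fin_two]⟩

theorem finite_isMonomial : {M | IsMonomial M}.Finite := by
  have h : {a : ℂ | a ^ 4 = 1}.Finite := by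
    refine Set.Finite.subset (Set.toFinite {1, -1, Complex.I, -Complex.I}) fun a ha => ?_
    simpa using fourth_root_cases ha
  refine ((h.image2 (fun a b => !![a, 0; 0, b]) h).union
    (h.image2 (fun a b => !![0, a; b, 0]) h)).subset ?_
  rintro M ⟨a, b, ha, hb, -, rfl | rfl⟩
  · exact .inl ⟨a, ha, b, hb, rfl⟩
  · exact .inr ⟨a, ha, b, hb, rfl⟩

theorem exp_quarter : Complex.exp (2 * Complex.I * Real.pi / (4 : ℕ)) = Complex.I := by
  rw [show 2 * Complex.I * Real.pi / (4 : ℕ) = Real.pi / 2 * Complex.I by push_cast; ring]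
  exact Complex.exp_pi_div_two_mul_I

theorem exp_neg_quarter :
    Complex.exp (-(2 * Complex.I * Real.pi / (4 : ℕ))) = -Complex.I := by
  rw [Complex.exp_neg, exp_quarter, Complex.inv_I]

theorem exp_half : Complex.exp (2 * Complex.I * (2 : ℕ) * Real.pi / (4 : ℕ)) = -1 := by
  rw [show 2 * Complex.I * (2 : ℕ) * Real.pi / (4 : ℕ) = Real.pi * Complex.I by push_cast; ring]
  exact Complex.exp_pi_mul_I

/-- Only this inclusion is used: it bounds the group and gives invariance. For transitivity on
fibres, the few elements needed are produced from generators. -/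
theorem isMonomial_of_mem_reflectionGroup {g : GL (Fin 2) ℂ} (hg : g ∈ reflectionGroup 4 2) :
    IsMonomial (g : Matrix (Fin 2) (Fin 2) ℂ) := by
  induction hg using Subgroup.closure_induction with
  | mem g hg =>
    rw [Set.mem_ofPred_eq, exp_quarter, exp_neg_quarter, exp_half] at hg
    rcases hg with h | h | h
    · exact ⟨1, 1, by simp, by simp, by simp, .inr h⟩
    · exact ⟨Complex.I, -Complex.I, by simp, by simp [Even.neg_pow (by decide : Even 4)], by simp,
        .inr h⟩
    · exact ⟨-1, 1, by simp [Even.neg_pow (by decide : Even 4)], by simp, by simp, .inl h⟩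
  | one => exact isMonomial_one
  | mul g h _ _ hg hh => exact hg.mul hh
  | inv g _ hg =>
    obtain ⟨N, hN, h⟩ := hg.exists_mul_eq_one
    rwa [Units.inv_eq_of_mul_eq_one_right h]

theorem mul_tau_sub_tau_mem {a : ℂ} (h : a ^ 4 = 1) : a * tau - tau ∈ gaussInt := by
  rcases fourth_root_cases h with rfl | rfl | rfl | rfl
  · simp
  · convert neg_mem two_mul_tau_mem using 1
    ring
  · rw [I_mul_tau]
    simpa using one_mem_gaussInt
  · convert sub_mem one_mem_gaussInt two_mul_tau_mem using 1
    linear_combination -I_mul_tau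

theorem IsMonomial.mulVec_mem {M : Matrix (Fin 2) (Fin 2) ℂ} (hM : IsMonomial M) :
    ∀ v ∈ gaussLattice, M *ᵥ v ∈ gaussLattice := by
  intro v hv
  rw [mem_gaussLattice] at hv ⊢
  have key : ∀ a : ℂ, a ^ 4 = 1 → ∀ j, a * v j ∈ gaussInt := by
    intro a ha j
    have h1 : v j ∈ gaussInt := hv j
    have h2 := mul_mem_gaussInt I_mem_gaussInt h1
    rcases fourth_root_cases ha with rfl | rfl | rfl | rfl <;> simpa
  obtain ⟨a, b, ha, hb, -, rfl | rfl⟩ := hM <;> rw [Fin.forall_fin_two]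
  · simpa [Matrix.mulVec, dotProduct] using! And.intro (key a ha 0) (key b hb 1)
  · simpa [Matrix.mulVec, dotProduct] using! And.intro (key a ha 1) (key b hb 0)

/-- The vector `(1 + i) / 2 · (1, 1)`. -/
def tauVec : Fin 2 → ℂ := ![tau, tau]

theorem IsMonomial.mulVec_tauVec {M : Matrix (Fin 2) (Fin 2) ℂ} (hM : IsMonomial M) :
    toTorus gaussLattice (M *ᵥ tauVec) = toTorus gaussLattice tauVec := by
  rw [toTorus_eq_iff]
  obtain ⟨a, b, ha, hb, -, rfl | rfl⟩ := hM <;>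
    simpa [Matrix.mulVec, dotProduct, tauVec] using
      And.intro (mul_tau_sub_tau_mem ha) (mul_tau_sub_tau_mem hb)

theorem toTorus_tauVec_add_tauVec :
    toTorus gaussLattice tauVec + toTorus gaussLattice tauVec = 0 := by
  change toTorus gaussLattice (tauVec + tauVec) = toTorus gaussLattice 0
  rw [toTorus_eq_iff]
  have := two_mul_tau_mem
  rw [two_mul] at this
  simpa [tauVec] using this

theorem toTorus_add (v w : Fin 2 → ℂ) :
    toTorus gaussLattice (v + w) = toTorus gaussLattice v + toTorus gaussLattice w := rfl

/-- The explicit form of the elements of the covering group. -/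
def IsAffine (e : Equiv.Perm (Torus gaussLattice)) : Prop :=
  ∃ M, IsMonomial M ∧ ∃ ε ∈ ({0, tauVec} : Set (Fin 2 → ℂ)), ∀ v,
    e (toTorus gaussLattice v) = toTorus gaussLattice (M *ᵥ v) + toTorus gaussLattice ε

theorem IsMonomial.mulVec_translation {M : Matrix (Fin 2) (Fin 2) ℂ} (hM : IsMonomial M)
    {ε : Fin 2 → ℂ} (hε : ε ∈ ({0, tauVec} : Set (Fin 2 → ℂ))) :
    toTorus gaussLattice (M *ᵥ ε) = toTorus gaussLattice ε := by
  rcases hε with rfl | rfl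
  · rw [Matrix.mulVec_zero]
  · exact hM.mulVec_tauVec

theorem translation_add_self {ε : Fin 2 → ℂ} (hε : ε ∈ ({0, tauVec} : Set (Fin 2 → ℂ))) :
    toTorus gaussLattice ε + toTorus gaussLattice ε = 0 := by
  rcases hε with rfl | rfl
  · exact add_zero _
  · exact toTorus_tauVec_add_tauVec

theorem exists_translation_add {ε δ : Fin 2 → ℂ} (hε : ε ∈ ({0, tauVec} : Set (Fin 2 → ℂ)))
    (hδ : δ ∈ ({0, tauVec} : Set (Fin 2 → ℂ))) : ∃ η ∈ ({0, tauVec} : Set (Fin 2 → ℂ)),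
      toTorus gaussLattice ε + toTorus gaussLattice δ = toTorus gaussLattice η := by
  rcases hε with rfl | rfl
  · exact ⟨δ, hδ, zero_add _⟩
  · rcases hδ with rfl | rfl
    · exact ⟨tauVec, by simp, add_zero _⟩
    · exact ⟨0, by simp, toTorus_tauVec_add_tauVec⟩

/-- The normal form is closed under products and inverses because `a * tau ≡ tau` for every fourth
root of unity `a`: the linear parts fix the translation, which has order two. -/
theorem isAffine_of_mem_coveringGroup {e : Equiv.Perm (Torus gaussLattice)}
    (he : e ∈ coveringGroup) : IsAffine e := by
  induction he using Subgroup.closure_induction with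
  | mem e he =>
    rcases he with ⟨g, hg, h⟩ | rfl
    · exact ⟨_, isMonomial_of_mem_reflectionGroup hg, 0, by simp, fun v => by
        rw [h, ← toTorus_add, add_zero]⟩
    · refine ⟨1, isMonomial_one, tauVec, by simp, fun v => ?_⟩
      rw [Matrix.one_mulVec]
      simp only [Equiv.coe_addRight]
      congr 2
      funext j
      fin_cases j <;> simp [tauVec, tau]
  | one => exact ⟨1, isMonomial_one, 0, by simp, fun v => by simp⟩
  | mul e f _ _ he hf =>
    obtain ⟨M, hM, ε, hε, h⟩ := he
    obtain ⟨N, hN, δ, hδ, h'⟩ := hf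
    obtain ⟨η, hη, h2⟩ := exists_translation_add hδ hε
    refine ⟨M * N, hM.mul hN, η, hη, fun v => ?_⟩
    rw [Equiv.Perm.mul_apply, h', ← toTorus_add, h, Matrix.mulVec_add, toTorus_add,
      hM.mulVec_translation hδ, add_assoc, h2, Matrix.mulVec_mulVec]
  | inv e _ he =>
    obtain ⟨M, hM, ε, hε, h⟩ := he
    obtain ⟨N, hN, hMN⟩ := hM.exists_mul_eq_one
    refine ⟨N, hN, ε, hε, fun v => ?_⟩
    rw [Equiv.Perm.inv_eq_iff_eq, ← toTorus_add, h, Matrix.mulVec_add, toTorus_add,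
      hM.mulVec_translation hε, add_assoc, translation_add_self hε, add_zero,
      Matrix.mulVec_mulVec, hMN, Matrix.one_mulVec]

theorem finite_coveringGroup : Finite coveringGroup := by
  choose M hM ε hε h using fun e : coveringGroup => isAffine_of_mem_coveringGroup e.2
  have : Finite ({M | IsMonomial M} ×ˢ ({0, tauVec} : Set (Fin 2 → ℂ)) : Set _) :=
    (finite_isMonomial.prod (Set.toFinite _)).to_subtype
  refine Finite.of_injective (fun e => (⟨(M e, ε e), hM e, hε e⟩ :
    ({M | IsMonomial M} ×ˢ ({0, tauVec} : Set (Fin 2 → ℂ)) : Set _))) fun e f hef => ?_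
  have hM' : M e = M f := congrArg (fun x => x.1.1) hef
  have hε' : ε e = ε f := congrArg (fun x => x.1.2) hef
  ext t
  obtain ⟨v, rfl⟩ := Submodule.Quotient.mk_surjective _ t
  change e.1 (toTorus gaussLattice v) = f.1 (toTorus gaussLattice v)
  rw [h, h, hM', hε']

theorem differentiableAt_mulVec {k : ℕ} (M : Matrix (Fin k) (Fin k) ℂ) (v : Fin k → ℂ) :
    DifferentiableAt ℂ (fun w => M *ᵥ w) v :=
  (LinearMap.toContinuousLinearMap M.mulVecLin).differentiableAt

theorem isHolomorphicTorusMap_torusMap {k : ℕ} (Γ : Submodule ℤ (Fin k → ℂ))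
    (M : Matrix (Fin k) (Fin k) ℂ) (hM : ∀ v ∈ Γ, M *ᵥ v ∈ Γ) :
    IsHolomorphicTorusMap Γ (torusMap Γ M hM) :=
  fun _ => ⟨fun w => M *ᵥ w, .of_forall fun w => ⟨differentiableAt_mulVec M w, rfl⟩⟩

theorem IsAffine.isHolomorphicTorusMap {e : Equiv.Perm (Torus gaussLattice)} (he : IsAffine e) :
    IsHolomorphicTorusMap gaussLattice e := by
  obtain ⟨M, -, ε, -, h⟩ := he
  exact fun _ => ⟨fun w => M *ᵥ w + ε, .of_forall fun w =>
    ⟨(differentiableAt_mulVec M w).add_const ε, h w⟩⟩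

theorem ellPair_mul_of_sq_eq_one {a : ℂ} (h : a ^ 2 = 1) (z : ℂ) :
    ellPair (a * z) = ellPair z := by
  rcases sq_eq_sq_iff_eq_or_eq_neg.1 (h.trans (one_pow 2).symm) with rfl | rfl
  · rw [one_mul]
  · rw [neg_one_mul, ellPair_neg]

theorem ellPair_mul_of_sq_eq_neg_one {a : ℂ} (h : a ^ 2 = -1) (z : ℂ) :
    Proportional (ellPair (a * z)) (flip (ellPair z)) := by
  have : (a * -Complex.I) ^ 2 = 1 := by
    rw [mul_pow, h, neg_sq, Complex.I_sq]
    norm_num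
  have e : a * z = (a * -Complex.I) * (Complex.I * z) := by
    linear_combination (a * z) * Complex.I_mul_I
  rw [e, ellPair_mul_of_sq_eq_one this]
  exact ellPair_I_mul z

theorem coverLift_swap (u v : ℂ) : coverLift ![u, v] = coverLift ![v, u] := by
  simp only [coverLift, Matrix.cons_val_zero, Matrix.cons_val_one,
    biform_comm (ellPair u) (ellPair v)]

/-- Signs are invisible to the even function `ell`. The condition `a² = b²` ensures that both
factors are flipped or neither is, which `biform` does not see. -/
theorem coverLift_mul {a b : ℂ} (ha : a ^ 4 = 1) (hab : a ^ 2 = b ^ 2) (u v : ℂ) :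
    coverLift ![a * u, b * v] = coverLift ![u, v] := by
  rcases sq_cases_of_pow_four ha with h | h
  · exact coverLift_eq (v := ![a * u, b * v]) (.of_eq (ellPair_mul_of_sq_eq_one h u))
      (.of_eq (ellPair_mul_of_sq_eq_one (hab ▸ h) v))
  · rw [coverLift_eq (v := ![a * u, b * v]) (ellPair_mul_of_sq_eq_neg_one h u)
      (ellPair_mul_of_sq_eq_neg_one (hab ▸ h) v)]
    simp only [coverLift, biform_flip, Matrix.cons_val_zero, Matrix.cons_val_one]

theorem mulVec_pair (a b c d u v : ℂ) :
    !![a, b; c, d] *ᵥ ![u, v] = ![a * u + b * v, c * u + d * v] := by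
  funext j
  fin_cases j <;> simp [Matrix.mulVec, dotProduct]

theorem eq_vecCons (v : Fin 2 → ℂ) : v = ![v 0, v 1] := by
  funext j
  fin_cases j <;> rfl

theorem coverLift_mulVec {M : Matrix (Fin 2) (Fin 2) ℂ} (hM : IsMonomial M) (v : Fin 2 → ℂ) :
    coverLift (M *ᵥ v) = coverLift v := by
  obtain ⟨a, b, ha, hb, hab, rfl | rfl⟩ := hM
  · rw [eq_vecCons v, ← coverLift_mul ha hab]
    congr 1
    rw [mulVec_pair]
    simp
  · rw [eq_vecCons v, ← coverLift_swap, ← coverLift_mul ha hab]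
    congr 1
    rw [mulVec_pair]
    simp

theorem coverLift_add_tauVec (v : Fin 2 → ℂ) : coverLift (v + tauVec) = coverLift v := by
  rw [coverLift_eq (v := v + tauVec) (ellPair_add_tau (v 0)) (ellPair_add_tau (v 1))]
  simp only [coverLift, biform_turn]

theorem cover_eq_of_mem {g : Equiv.Perm (Torus gaussLattice)} (hg : g ∈ coveringGroup)
    (t : Torus gaussLattice) : cover (g t) = cover t := by
  obtain ⟨M, hM, ε, hε, h⟩ := isAffine_of_mem_coveringGroup hg
  obtain ⟨v, rfl⟩ := Submodule.Quotient.mk_surjective _ t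
  change cover (g (toTorus gaussLattice v)) = cover (toTorus gaussLattice v)
  rw [h, ← toTorus_add, cover_toTorus, cover_toTorus, ← coverLift_mulVec hM v]
  rcases hε with rfl | rfl
  · rw [add_zero]
  · exact coverLift_add_tauVec _

/-! ### Fibres of the covering are orbits. -/

/-- Two points of `ℂ²` have images in the same orbit of the covering group. -/
def SameOrbit (v w : Fin 2 → ℂ) : Prop :=
  ∃ g ∈ coveringGroup, g (toTorus gaussLattice v) = toTorus gaussLattice w

theorem SameOrbit.trans {u v w : Fin 2 → ℂ} (h : SameOrbit u v) (h' : SameOrbit v w) :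
    SameOrbit u w := by
  obtain ⟨g, hg, h⟩ := h
  obtain ⟨g', hg', h'⟩ := h'
  exact ⟨g' * g, mul_mem hg' hg, by rw [Equiv.Perm.mul_apply, h, h']⟩

theorem SameOrbit.symm {u v : Fin 2 → ℂ} (h : SameOrbit u v) : SameOrbit v u := by
  obtain ⟨g, hg, h⟩ := h
  exact ⟨g⁻¹, inv_mem hg, by rw [Equiv.Perm.inv_eq_iff_eq, h]⟩

theorem SameOrbit.of_sub_mem {u v u' v' : ℂ} (h : u - u' ∈ gaussInt) (h' : v - v' ∈ gaussInt) :
    SameOrbit ![u, v] ![u', v'] :=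
  ⟨1, one_mem _, toTorus_eq_iff.2 ⟨h, h'⟩⟩

theorem sameOrbit_mulVec {g : GL (Fin 2) ℂ} (hg : g ∈ reflectionGroup 4 2) (v : Fin 2 → ℂ) :
    SameOrbit v ((g : Matrix (Fin 2) (Fin 2) ℂ) *ᵥ v) := by
  have h1 := (isMonomial_of_mem_reflectionGroup hg).mulVec_mem
  have h2 := (isMonomial_of_mem_reflectionGroup (inv_mem hg)).mulVec_mem
  let e : Equiv.Perm (Torus gaussLattice) :=
    { toFun := torusMap gaussLattice _ h1
      invFun := torusMap gaussLattice _ h2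
      left_inv := by
        intro t
        obtain ⟨v, rfl⟩ := Submodule.Quotient.mk_surjective _ t
        change toTorus gaussLattice _ = toTorus gaussLattice v
        congr 1
        change (g⁻¹ : GL (Fin 2) ℂ).1 *ᵥ (g.1 *ᵥ v) = v
        rw [Matrix.mulVec_mulVec, Units.inv_mul, Matrix.one_mulVec]
      right_inv := by
        intro t
        obtain ⟨v, rfl⟩ := Submodule.Quotient.mk_surjective _ t
        change toTorus gaussLattice _ = toTorus gaussLattice v
        congr 1
        change g.1 *ᵥ ((g⁻¹ : GL (Fin 2) ℂ).1 *ᵥ v) = v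
        rw [Matrix.mulVec_mulVec, Units.mul_inv, Matrix.one_mulVec] }
  exact ⟨e, Subgroup.subset_closure (.inl ⟨g, hg, fun _ => rfl⟩), rfl⟩

theorem sameOrbit_swap (u v : ℂ) : SameOrbit ![u, v] ![v, u] := by
  have hg : Matrix.GeneralLinearGroup.mkOfDetNeZero (!![0, 1; 1, 0] : Matrix (Fin 2) (Fin 2) ℂ)
      (by simp [Matrix.det_fin_two]) ∈ reflectionGroup 4 2 :=
    Subgroup.subset_closure (.inl rfl)
  convert sameOrbit_mulVec hg ![u, v] using 1
  change _ = !![0, 1; 1, 0] *ᵥ _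
  rw [mulVec_pair]
  simp

theorem sameOrbit_neg_left (u v : ℂ) : SameOrbit ![u, v] ![-u, v] := by
  have hg : Matrix.GeneralLinearGroup.mkOfDetNeZero (!![-1, 0; 0, 1] : Matrix (Fin 2) (Fin 2) ℂ)
      (by simp [Matrix.det_fin_two]) ∈ reflectionGroup 4 2 := by
    refine Subgroup.subset_closure (.inr (.inr ?_))
    rw [exp_half]
    rfl
  convert sameOrbit_mulVec hg ![u, v] using 1
  change _ = !![-1, 0; 0, 1] *ᵥ _
  rw [mulVec_pair]
  simp

theorem sameOrbit_neg_right (u v : ℂ) : SameOrbit ![u, v] ![u, -v] :=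
  ((sameOrbit_swap u v).trans (sameOrbit_neg_left v u)).trans (sameOrbit_swap (-v) u)

theorem sameOrbit_I_mul (u v : ℂ) :
    SameOrbit ![u, v] ![Complex.I * u, Complex.I * v] := by
  have hg : Matrix.GeneralLinearGroup.mkOfDetNeZero
      (!![0, Complex.I; -Complex.I, 0] : Matrix (Fin 2) (Fin 2) ℂ)
      (by simp [Matrix.det_fin_two]) ∈ reflectionGroup 4 2 := by
    refine Subgroup.subset_closure (.inr (.inl ?_))
    rw [exp_quarter, exp_neg_quarter]
    rfl
  have h : SameOrbit ![u, v] ![Complex.I * v, -(Complex.I * u)] := by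
    convert sameOrbit_mulVec hg ![u, v] using 1
    change _ = !![0, Complex.I; -Complex.I, 0] *ᵥ _
    rw [mulVec_pair]
    simp
  -- The scalar `i` is the second generator followed by a sign change and the swap.
  convert (h.trans (sameOrbit_neg_right _ _)).trans (sameOrbit_swap _ _) using 2
  rw [neg_neg]

theorem sameOrbit_add_tau (u v : ℂ) : SameOrbit ![u, v] ![u + tau, v + tau] := by
  refine ⟨_, Subgroup.subset_closure (.inr rfl), ?_⟩
  change toTorus gaussLattice (_ + _) = _
  congr 1
  simp [tau]

theorem sameOrbit_of_proportional {u v u' v' : ℂ} (hu : Proportional (ellPair u) (ellPair u'))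
    (hv : Proportional (ellPair v) (ellPair v')) : SameOrbit ![u, v] ![u', v'] := by
  rw [ellPair_proportional_iff] at hu hv
  have neg : ∀ {a b : ℂ}, a + b ∈ gaussInt → -a - b ∈ gaussInt := fun {a b} h => by
    convert neg_mem h using 1
    ring
  rcases hu with hu | hu <;> rcases hv with hv | hv
  · exact .of_sub_mem hu hv
  · exact (sameOrbit_neg_right u v).trans (.of_sub_mem hu (neg hv))
  · exact (sameOrbit_neg_left u v).trans (.of_sub_mem (neg hu) hv)
  · exact ((sameOrbit_neg_left u v).trans (sameOrbit_neg_right (-u) v)).trans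
      (.of_sub_mem (neg hu) (neg hv))

/-- Each element of the Klein four-group lifts to a map `θ` acting on both coordinates of `ℂ²`:
`flip` to multiplication by `i`, `turn` to translation by `tau`. After applying `θ`, the points
differ by the swap, signs and periods. -/
theorem sameOrbit_of_coverLift_eq {v w : Fin 2 → ℂ} (h : coverLift v = coverLift w) :
    SameOrbit v w := by
  obtain ⟨c, hc⟩ := (Projectivization.mk_eq_mk_iff' _ _ _ _ _).1 h
  rw [eq_vecCons v, eq_vecCons w]
  generalize v 0 = u at *
  generalize v 1 = v at *
  generalize w 0 = u' at *
  generalize w 1 = v' at *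
  obtain ⟨φ, hφ, hpq⟩ := proportional_of_biform_eq (ellPair_ne_zero u) (ellPair_ne_zero v)
    (ellPair_ne_zero u') (ellPair_ne_zero v') hc.symm
  obtain ⟨θ, hθ, hθ'⟩ : ∃ θ : ℂ → ℂ, (∀ z, Proportional (ellPair (θ z)) (φ (ellPair z))) ∧
      ∀ a b, SameOrbit ![a, b] ![θ a, θ b] := by
    rcases hφ with rfl | rfl | rfl | rfl
    · exact ⟨id, fun z => .refl _, fun a b => .of_sub_mem (by simp) (by simp)⟩
    · exact ⟨_, ellPair_I_mul, sameOrbit_I_mul⟩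
    · exact ⟨_, ellPair_add_tau, sameOrbit_add_tau⟩
    · exact ⟨fun z => Complex.I * (z + tau),
        fun z => (ellPair_I_mul _).trans (ellPair_add_tau z).flip,
        fun a b => (sameOrbit_add_tau a b).trans (sameOrbit_I_mul _ _)⟩
  rcases hpq with ⟨hp, hq⟩ | ⟨hp, hq⟩
  · exact (sameOrbit_of_proportional (hp.trans (hθ _).symm) (hq.trans (hθ _).symm)).trans
      (hθ' _ _).symm
  · exact ((sameOrbit_of_proportional (hp.trans (hθ _).symm) (hq.trans (hθ _).symm)).trans
      (hθ' _ _).symm).trans (sameOrbit_swap _ _)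

theorem isGaloisCovering_cover : IsGaloisCovering gaussLattice cover coveringGroup where
  finite := finite_coveringGroup
  holomorphic_aut _ hg := (isAffine_of_mem_coveringGroup hg).isHolomorphicTorusMap
  holomorphic := cover_holomorphic
  surjective := cover_surjective
  fibre a b := by
    constructor
    · intro h
      obtain ⟨v, rfl⟩ := Submodule.Quotient.mk_surjective _ a
      obtain ⟨w, rfl⟩ := Submodule.Quotient.mk_surjective _ b
      change cover (toTorus gaussLattice v) = cover (toTorus gaussLattice w) at h
      rw [cover_toTorus, cover_toTorus] at h
      exact sameOrbit_of_coverLift_eq h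
    · rintro ⟨g, hg, rfl⟩
      exact (cover_eq_of_mem hg a).symm

theorem isLattice_gaussLattice : IsLattice gaussLattice := by
  constructor
  · have h1 : DiscreteTopology (Fin 2 → gaussInt) := inferInstance
    let φ : gaussLattice → Fin 2 → gaussInt := fun v j => ⟨v.1 j, mem_gaussLattice.1 v.2 j⟩
    have hφ : Continuous φ := continuous_pi fun j =>
      ((continuous_apply j).comp continuous_subtype_val).subtype_mk _
    refine DiscreteTopology.of_continuous_injective hφ fun v w h => ?_
    ext j
    exact congrArg Subtype.val (congrFun h j)
  · rw [eq_top_iff]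
    intro v _
    have mem : ∀ u w : ℂ, u ∈ gaussInt → w ∈ gaussInt →
        ![u, w] ∈ Submodule.span ℝ (gaussLattice : Set (Fin 2 → ℂ)) := fun u w hu hw =>
      Submodule.subset_span (mem_gaussLattice.2 (Fin.forall_fin_two.2 ⟨hu, hw⟩))
    have e : v = (v 0).re • ![1, 0] + (v 0).im • ![Complex.I, 0] +
        ((v 1).re • ![0, 1] + (v 1).im • ![0, Complex.I]) := by
      funext j
      fin_cases j <;> simp
    rw [e]
    have h1 := one_mem_gaussInt
    have hI := I_mem_gaussInt
    exact add_mem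
      (add_mem (Submodule.smul_mem _ _ (mem _ _ h1 (zero_mem _)))
        (Submodule.smul_mem _ _ (mem _ _ hI (zero_mem _))))
      (add_mem (Submodule.smul_mem _ _ (mem _ _ (zero_mem _) h1))
        (Submodule.smul_mem _ _ (mem _ _ (zero_mem _) hI)))

/-! ### Critical sets and critical finiteness. -/

/-- The linear forms `-x + y + z`, `x - y + z`, `x + y - z`. -/
def linForm (i : Fin 3) (v : Fin 3 → ℂ) : ℂ := v 0 + v 1 + v 2 - 2 * v i

theorem linForm_sum (v : Fin 3 → ℂ) :
    linForm 0 v + linForm 1 v + linForm 2 v = v 0 + v 1 + v 2 := by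
  simp only [linForm]
  ring

theorem two_mul_eq_linForm (v : Fin 3 → ℂ) (i : Fin 3) :
    2 * v i = linForm 0 v + linForm 1 v + linForm 2 v - linForm i v := by
  rw [linForm_sum, linForm]
  ring

theorem linForm_smul (c : ℂ) (i : Fin 3) (v : Fin 3 → ℂ) :
    linForm i (c • v) = c * linForm i v := by
  simp only [linForm, Pi.smul_apply, smul_eq_mul]
  ring

theorem linForm_ext {v w : Fin 3 → ℂ} (h : ∀ i, linForm i v = linForm i w) : v = w := by
  funext i
  have h1 := two_mul_eq_linForm v i
  rw [h, h, h, h, ← two_mul_eq_linForm] at h1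
  exact mul_left_cancel₀ two_ne_zero h1

theorem exists_linForm_eq (t : Fin 3 → ℂ) : ∃ v, ∀ i, linForm i v = t i :=
  ⟨fun i => (t 0 + t 1 + t 2 - t i) / 2, fun i => by simp only [linForm]; ring⟩

/-- The quadratic map whose components are the squares of the forms `linForm i`, in the order
given by a permutation. -/
def squareMap (π : Equiv.Perm (Fin 3)) (v : Fin 3 → ℂ) : Fin 3 → ℂ := fun i => linForm (π i) v ^ 2

/-- The self-map `f` of `ℙ²` is induced by `squareMap π`. -/
def IsInducedBySquares (f : ProjSpace 2 → ProjSpace 2) (π : Equiv.Perm (Fin 3)) : Prop :=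
  ∀ (v : Fin 3 → ℂ) (hv : v ≠ 0), ∃ h : squareMap π v ≠ 0,
    f (Projectivization.mk ℂ v hv) = Projectivization.mk ℂ (squareMap π v) h

theorem isInducedBySquares_quadraticMap {F : (Fin 3 → ℂ) → (Fin 3 → ℂ)}
    (h0 : ∀ v, F v = 0 → v = 0) (hF : ∀ (t : ℂ) (v : Fin 3 → ℂ), F (t • v) = t ^ 2 • F v)
    {π : Equiv.Perm (Fin 3)} (h : ∀ v, F v = squareMap π v) :
    IsInducedBySquares (quadraticMap F h0 hF) π := by
  obtain rfl : F = squareMap π := funext h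
  exact fun v hv => ⟨fun h => hv (h0 v h), rfl⟩

theorem isInducedBySquares_f₁ : IsInducedBySquares f₁ 1 :=
  isInducedBySquares_quadraticMap _ _ fun v => by
    funext j
    fin_cases j <;> simp [F₁, squareMap, linForm] <;> ring

theorem isInducedBySquares_f₂ : IsInducedBySquares f₂ (Equiv.swap 0 1) :=
  isInducedBySquares_quadraticMap _ _ fun v => by
    have h : Equiv.swap (0 : Fin 3) 1 2 = 2 := by decide
    funext j
    fin_cases j <;> simp [F₂, squareMap, linForm, h] <;> ring

theorem isInducedBySquares_f₃ : IsInducedBySquares f₃ (finRotate 3).symm :=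
  isInducedBySquares_quadraticMap _ _ fun v => by
    have h0 : (finRotate 3).symm 0 = 2 := by decide
    have h1 : (finRotate 3).symm 1 = 0 := by decide
    have h2 : (finRotate 3).symm 2 = 1 := by decide
    funext j
    fin_cases j <;> simp only [Fin.zero_eta, Fin.mk_one, Fin.reduceFinMk, F₃, squareMap, h0, h1, h2,
      linForm, Matrix.cons_val] <;> ring

/-- The set of points of `ℙ²` with a representative satisfying a given property. -/
def locus (P : (Fin 3 → ℂ) → Prop) : Set (ProjSpace 2) :=
  {p | ∃ (v : Fin 3 → ℂ) (hv : v ≠ 0), Projectivization.mk ℂ v hv = p ∧ P v}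

theorem mk_mem_locus {P : (Fin 3 → ℂ) → Prop} (hP : ∀ (c : ℂ) v, P v → P (c • v))
    {v : Fin 3 → ℂ} (hv : v ≠ 0) : Projectivization.mk ℂ v hv ∈ locus P ↔ P v := by
  refine ⟨?_, fun h => ⟨v, hv, rfl, h⟩⟩
  rintro ⟨w, hw, h, hPw⟩
  obtain ⟨c, rfl⟩ := (Projectivization.mk_eq_mk_iff' _ _ _ _ _).1 h.symm
  exact hP c w hPw

/-- The product of the coordinates vanishes. -/
def OnTriangle (v : Fin 3 → ℂ) : Prop := ∃ i, v i = 0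

/-- Two coordinates coincide. -/
def OnDiagonals (v : Fin 3 → ℂ) : Prop := ∃ i j, i ≠ j ∧ v i = v j

/-- One of the forms `linForm i` vanishes. -/
def OnCriticalLines (v : Fin 3 → ℂ) : Prop := ∃ i, linForm i v = 0

theorem differentiable_linForm (i : Fin 3) : Differentiable ℂ (linForm i) := by
  unfold linForm
  fun_prop

theorem hasFDerivAt_squareMap_apply (π : Equiv.Perm (Fin 3)) (v : Fin 3 → ℂ) (j : Fin 3) :
    ∃ G' : (Fin 3 → ℂ) →L[ℂ] ℂ, HasFDerivAt (fun v => squareMap π v j) G' v ∧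
      ∀ w, G' w = 2 * linForm (π j) v * linForm (π j) w := by
  let l : (Fin 3 → ℂ) →ₗ[ℂ] ℂ :=
    { toFun := linForm (π j)
      map_add' := fun v w => by simp only [linForm, Pi.add_apply]; ring
      map_smul' := fun c v => linForm_smul c (π j) v }
  have h : HasFDerivAt (linForm (π j)) (LinearMap.toContinuousLinearMap l) v :=
    (LinearMap.toContinuousLinearMap l).hasFDerivAt
  refine ⟨_, h.pow 2, fun w => ?_⟩
  simp only [smul_apply, Nat.add_one_sub_one, pow_one, nsmul_eq_mul,
    smul_eq_mul, Nat.cast_ofNat]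
  rfl

theorem differentiable_squareMap (π : Equiv.Perm (Fin 3)) : Differentiable ℂ (squareMap π) :=
  differentiable_pi.2 fun i => (differentiable_linForm (π i)).pow 2

/-- If no form vanishes at `v`, a kernel direction `w` has its form values proportional to those of
`v`, so `w` is a multiple of `v`. -/
theorem onCriticalLines_of_isLocalLift {f : ProjSpace 2 → ProjSpace 2} {π : Equiv.Perm (Fin 3)}
    (hf : IsInducedBySquares f π) {L : (Fin 3 → ℂ) → (Fin 3 → ℂ)} {v w : Fin 3 → ℂ}
    (hL : IsLocalLift f L v) (hw : w ∉ Submodule.span ℂ {v})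
    (hd : fderiv ℂ L v w ∈ Submodule.span ℂ {L v}) : OnCriticalLines v := by
  by_contra hcrit
  simp only [OnCriticalLines, not_exists] at hcrit
  obtain ⟨c, hc⟩ := Submodule.mem_span_singleton.1 hd
  have hev : ∀ᶠ u in 𝓝 v, ∃ a : ℂ, a ≠ 0 ∧ L u = a • squareMap π u := by
    filter_upwards [hL] with u hu
    obtain ⟨-, hu0, hLu, h⟩ := hu
    obtain ⟨h', e⟩ := hf u hu0
    rw [e] at h
    obtain ⟨a, ha⟩ := (Projectivization.mk_eq_mk_iff' _ _ _ _ _).1 h.symm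
    exact ⟨a, fun h0 => hLu (by rw [← ha, h0, zero_smul]), ha.symm⟩
  obtain ⟨a, ha, haL⟩ := hev.self_of_nhds
  have hLd := hasFDerivAt_pi'.1 hL.self_of_nhds.1.hasFDerivAt
  have key : ∀ i j, linForm (π i) v * linForm (π j) w = linForm (π j) v * linForm (π i) w := by
    intro i j
    obtain ⟨Gi, hGi, hGi'⟩ := hasFDerivAt_squareMap_apply π v i
    obtain ⟨Gj, hGj, hGj'⟩ := hasFDerivAt_squareMap_apply π v j
    have hc' : ∀ i, fderiv ℂ L v w i = c * L v i := fun i => by rw [← hc]; rfl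
    -- Differentiating `Lᵢ Sⱼ = Lⱼ Sᵢ`, where `S` is the squaring map, avoids any regularity of the
    -- factor between `L` and `S`.
    have h := ((hLd i).mul hGj).unique (((hLd j).mul hGi).congr_of_eventuallyEq (by
      filter_upwards [hev] with u hu
      obtain ⟨b, -, hb⟩ := hu
      simp only [Pi.mul_apply, hb, Pi.smul_apply, smul_eq_mul]
      ring))
    have h2 := congrArg (fun A => A w) h
    simp [hGi', hGj', hc', haL, squareMap] at h2
    have hi := hcrit (π i)
    have hj := hcrit (π j)
    refine mul_left_cancel₀ (a := 2 * a * linForm (π i) v * linForm (π j) v)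
      (by simp [ha, hi, hj]) ?_
    linear_combination h2
  refine hw (Submodule.mem_span_singleton.2 ⟨linForm (π 0) w / linForm (π 0) v, ?_⟩)
  refine linForm_ext fun i => ?_
  rw [linForm_smul, div_mul_eq_mul_div, div_eq_iff (hcrit _)]
  have := key 0 (π.symm i)
  rw [π.apply_symm_apply] at this
  linear_combination -this

theorem criticalSet_eq {f : ProjSpace 2 → ProjSpace 2} {π : Equiv.Perm (Fin 3)}
    (hf : IsInducedBySquares f π) : criticalSet f = locus OnCriticalLines := by
  ext p
  constructor
  · rintro ⟨v, hv, rfl, L, hL, w, hw, hd⟩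
    exact ⟨v, hv, rfl, onCriticalLines_of_isLocalLift hf hL hw hd⟩
  · rintro ⟨v, hv, rfl, i, hi⟩
    refine ⟨v, hv, rfl, squareMap π, ?_, ?_⟩
    · filter_upwards [isOpen_ne.mem_nhds hv] with u hu
      obtain ⟨h, e⟩ := hf u hu
      exact ⟨differentiable_squareMap π u, hu, h, e⟩
    · obtain ⟨w, hw⟩ := exists_linForm_eq (Pi.single i 1)
      refine ⟨w, fun h => ?_, ?_⟩
      · obtain ⟨c, rfl⟩ := Submodule.mem_span_singleton.1 h
        have := hw i
        rw [linForm_smul, hi] at this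
        simp at this
      · have : fderiv ℂ (squareMap π) v w = 0 := by
          funext j
          obtain ⟨G', hG, hG'⟩ := hasFDerivAt_squareMap_apply π v j
          have h1 := hasFDerivAt_pi'.1 (differentiable_squareMap π v).hasFDerivAt j
          have h2 := congrArg (fun A => A w) (h1.unique hG)
          simp only [hG', hw] at h2
          refine h2.trans ?_
          by_cases hj : π j = i
          · simp [hj, hi]
          · simp [hj]
        rw [this]
        exact zero_mem _

theorem exists_sq_eq (u : Fin 3 → ℂ) : ∃ s : Fin 3 → ℂ, ∀ i, s i ^ 2 = u i := by
  choose s hs using fun i => IsAlgClosed.exists_pow_nat_eq (u i) two_pos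
  exact ⟨s, hs⟩

theorem exists_apply_mk_eq {f : ProjSpace 2 → ProjSpace 2} {π : Equiv.Perm (Fin 3)}
    (hf : IsInducedBySquares f π) {u : Fin 3 → ℂ} (hu : u ≠ 0) {t : Fin 3 → ℂ}
    (ht : ∀ i, t (π i) ^ 2 = u i) : ∃ (v : Fin 3 → ℂ) (hv : v ≠ 0),
      f (Projectivization.mk ℂ v hv) = Projectivization.mk ℂ u hu ∧ ∀ i, linForm i v = t i := by
  obtain ⟨v, hv⟩ := exists_linForm_eq t
  have e : squareMap π v = u := funext fun i => by rw [squareMap, hv, ht]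
  have hv0 : v ≠ 0 := by
    rintro rfl
    refine hu (e ▸ funext fun i => ?_)
    simp [squareMap, linForm]
  obtain ⟨h, h'⟩ := hf v hv0
  refine ⟨v, hv0, ?_, hv⟩
  rw [h']
  congr 1

theorem image_criticalLines {f : ProjSpace 2 → ProjSpace 2} {π : Equiv.Perm (Fin 3)}
    (hf : IsInducedBySquares f π) : f '' locus OnCriticalLines = locus OnTriangle := by
  ext p
  constructor
  · rintro ⟨_, ⟨v, hv, rfl, i, hi⟩, rfl⟩
    obtain ⟨h, e⟩ := hf v hv
    exact ⟨_, h, e.symm, π.symm i, by simp [squareMap, hi]⟩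
  · rintro ⟨u, hu, rfl, i, hi⟩
    obtain ⟨s, hs⟩ := exists_sq_eq u
    obtain ⟨v, hv, h, hl⟩ := exists_apply_mk_eq hf hu (t := s ∘ π.symm) (by simp [hs])
    refine ⟨_, ⟨v, hv, rfl, π i, ?_⟩, h⟩
    rw [hl, ← sq_eq_zero_iff]
    simp [hs, hi]

theorem exists_third (i j : Fin 3) (h : i ≠ j) :
    ∃ k, ∀ t : Fin 3 → ℂ, t 0 + t 1 + t 2 - t k = t i + t j := by
  fin_cases i <;> fin_cases j <;> first
    | exact absurd rfl h
    | exact ⟨0, fun t => by simp only [Fin.mk_one, Fin.reduceFinMk]; ring1⟩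
    | exact ⟨1, fun t => by simp only [Fin.zero_eta, Fin.mk_one, Fin.reduceFinMk]; ring1⟩
    | exact ⟨2, fun t => by simp only [Fin.zero_eta, Fin.mk_one]; ring1⟩

theorem exists_others (k : Fin 3) :
    ∃ i j : Fin 3, i ≠ j ∧ ∀ t : Fin 3 → ℂ, t 0 + t 1 + t 2 - t k = t i + t j := by
  fin_cases k
  · exact ⟨1, 2, by decide, fun t => by simp; ring⟩
  · exact ⟨0, 2, by decide, fun t => by simp; ring⟩
  · exact ⟨0, 1, by decide, fun t => by simp⟩

/-- Twice a coordinate is the sum of the two other forms, so its vanishing means that those forms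
are opposite and their squares agree. -/
theorem image_triangle {f : ProjSpace 2 → ProjSpace 2} {π : Equiv.Perm (Fin 3)}
    (hf : IsInducedBySquares f π) : f '' locus OnTriangle = locus OnDiagonals := by
  ext p
  constructor
  · rintro ⟨_, ⟨v, hv, rfl, k, hk⟩, rfl⟩
    obtain ⟨h, e⟩ := hf v hv
    obtain ⟨i, j, hij, ht⟩ := exists_others k
    refine ⟨_, h, e.symm, π.symm i, π.symm j, by simpa using hij, ?_⟩
    have h1 := ht fun i => linForm i v
    rw [← two_mul_eq_linForm, hk, mul_zero] at h1
    simp only [squareMap, Equiv.apply_symm_apply]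
    rw [eq_neg_of_add_eq_zero_left h1.symm, neg_sq]
  · rintro ⟨u, hu, rfl, i, j, hij, huij⟩
    obtain ⟨s, hs⟩ := exists_sq_eq u
    obtain ⟨v, hv, h, hl⟩ := exists_apply_mk_eq hf hu
      -- The square root at `j` is chosen opposite to the one at `i`, making the sum of the two
      -- forms vanish.
      (t := Function.update (s ∘ π.symm) (π j) (-s i)) (fun m => by
        by_cases hm : m = j
        · subst hm
          simp [hs, huij]
        · simp [hm, hs])
    obtain ⟨k, hk⟩ := exists_third (π i) (π j) (by simpa using hij)
    refine ⟨_, ⟨v, hv, rfl, k, ?_⟩, h⟩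
    have h1 := hk fun i => linForm i v
    rw [← two_mul_eq_linForm] at h1
    simpa [hl, hij] using h1

theorem image_diagonals {f : ProjSpace 2 → ProjSpace 2} {π : Equiv.Perm (Fin 3)}
    (hf : IsInducedBySquares f π) : f '' locus OnDiagonals ⊆ locus OnDiagonals := by
  rintro _ ⟨_, ⟨v, hv, rfl, i, j, hij, hvij⟩, rfl⟩
  obtain ⟨h, e⟩ := hf v hv
  refine ⟨_, h, e.symm, π.symm i, π.symm j, by simpa using hij, ?_⟩
  simp [squareMap, linForm, hvij]

/-- The first image is the triangle, the second the diagonals, and all later images stay in the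
diagonals. -/
theorem postcriticalSet_eq {f : ProjSpace 2 → ProjSpace 2} {π : Equiv.Perm (Fin 3)}
    (hf : IsInducedBySquares f π) :
    ⋃ n ∈ Set.Ici 1, f^[n] '' criticalSet f = locus OnTriangle ∪ locus OnDiagonals := by
  have hit : ∀ m, f^[m] '' locus OnDiagonals ⊆ locus OnDiagonals := by
    intro m
    induction m with
    | zero => simp
    | succ m ih =>
      rw [Function.iterate_succ, Set.image_comp]
      exact (Set.image_mono (image_diagonals hf)).trans ih
  rw [criticalSet_eq hf]
  refine subset_antisymm (Set.iUnion₂_subset fun n hn => ?_) (Set.union_subset ?_ ?_)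
  · obtain ⟨m, rfl⟩ := Nat.exists_eq_add_of_le' (Set.mem_Ici.1 hn)
    rw [Function.iterate_succ, Set.image_comp, image_criticalLines hf]
    cases m with
    | zero => simp
    | succ m =>
      rw [Function.iterate_succ, Set.image_comp, image_triangle hf]
      exact (hit m).trans Set.subset_union_right
  · refine (Set.subset_iUnion₂_of_subset 1 (Set.mem_Ici.2 le_rfl) ?_)
    rw [Function.iterate_one, image_criticalLines hf]
  · refine (Set.subset_iUnion₂_of_subset 2 (Set.mem_Ici.2 one_le_two) ?_)
    rw [Function.iterate_succ, Function.iterate_one, Set.image_comp, image_criticalLines hf,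
      image_triangle hf]

theorem isCriticallyFinite_of_isInducedBySquares {f : ProjSpace 2 → ProjSpace 2}
    {π : Equiv.Perm (Fin 3)} (hf : IsInducedBySquares f π) : IsCriticallyFinite f := by
  open MvPolynomial in
  let p : MvPolynomial (Fin 3) ℂ :=
    X 0 * X 1 * X 2 * ((X 0 - X 1) * (X 1 - X 2) * (X 0 - X 2))
  have hX := fun i : Fin 3 => MvPolynomial.isHomogeneous_X ℂ i
  rw [IsCriticallyFinite, postcriticalSet_eq hf]
  refine ⟨{p}, ?_, fun v hv => ?_⟩
  · rintro _ rfl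
    exact ⟨_, (((hX 0).mul (hX 1)).mul (hX 2)).mul
      ((((hX 0).sub (hX 1)).mul ((hX 1).sub (hX 2))).mul ((hX 0).sub (hX 2)))⟩
  · rw [Set.mem_union, mk_mem_locus, mk_mem_locus]
    · simp only [Set.mem_singleton_iff, forall_eq, p, map_mul, map_sub, MvPolynomial.eval_X,
        mul_eq_zero, sub_eq_zero]
      refine or_congr ?_ ?_
      · simp [OnTriangle, Fin.exists_fin_succ, or_assoc]
      · simp [OnDiagonals, Fin.exists_fin_succ]
        grind
    · rintro c v ⟨i, j, hij, h⟩
      exact ⟨i, j, hij, by simp [h]⟩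
    · rintro c v ⟨i, h⟩
      exact ⟨i, by simp [h]⟩

/-! ### Degree two and the Lattès property. -/

theorem isEndomorphismOfDegree_two {f : ProjSpace 2 → ProjSpace 2}
    {π : Equiv.Perm (Fin 3)} (hf : IsInducedBySquares f π) : IsEndomorphismOfDegree 2 f := by
  have hX := fun i : Fin 3 => MvPolynomial.isHomogeneous_X ℂ i
  refine ⟨fun j => (MvPolynomial.X 0 + MvPolynomial.X 1 + MvPolynomial.X 2
    - MvPolynomial.X (π j) - MvPolynomial.X (π j)) ^ 2, fun j => ?_, fun v hv => ?_⟩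
  · exact (((((hX 0).add (hX 1)).add (hX 2)).sub (hX (π j))).sub (hX (π j))).pow 2
  · obtain ⟨h, e⟩ := hf v hv
    have : (fun j => MvPolynomial.eval v ((MvPolynomial.X 0 + MvPolynomial.X 1 + MvPolynomial.X 2
        - MvPolynomial.X (π j) - MvPolynomial.X (π j)) ^ 2)) = squareMap π v := by
      funext j
      simp [squareMap, linForm]
      ring
    refine ⟨by rwa [this], ?_⟩
    rw [e]
    congr 1
    exact this.symm

theorem isLattesExample_of_semiconj {f : ProjSpace 2 → ProjSpace 2} {π : Equiv.Perm (Fin 3)}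
    (hf : IsInducedBySquares f π) {M : Matrix (Fin 2) (Fin 2) ℂ}
    (hM : ∀ v ∈ gaussLattice, M *ᵥ v ∈ gaussLattice)
    (h : Function.Semiconj cover (torusMap gaussLattice M hM) f) : IsLattesExample f :=
  ⟨⟨2, le_rfl, isEndomorphismOfDegree_two hf⟩, gaussLattice, isLattice_gaussLattice,
    coveringGroup, cover, _, isGaloisCovering_cover, isHolomorphicTorusMap_torusMap _ M hM, h⟩

end Lattes

end

theorem proposition1p2 :
    (Lattes.IsCriticallyFinite Lattes.f₁ ∧ Lattes.IsCriticallyFinite Lattes.f₂ ∧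
      Lattes.IsCriticallyFinite Lattes.f₃) ∧
    (Lattes.IsLattesExample Lattes.f₁ ∧ Lattes.IsLattesExample Lattes.f₂ ∧
      Lattes.IsLattesExample Lattes.f₃) ∧
    ∃ σ : Lattes.Torus Lattes.gaussLattice → Lattes.ProjSpace 2,
      Lattes.IsGaloisCovering Lattes.gaussLattice σ Lattes.coveringGroup ∧
      Function.Semiconj σ
        (Lattes.torusMap Lattes.gaussLattice Lattes.D₁ Lattes.D₁_mem) Lattes.f₁ ∧
      Function.Semiconj σ
        (Lattes.torusMap Lattes.gaussLattice Lattes.D₂ Lattes.D₂_mem) Lattes.f₂ ∧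
      Function.Semiconj σ
        (Lattes.torusMap Lattes.gaussLattice Lattes.D₃ Lattes.D₃_mem) Lattes.f₃ := by
  open Lattes in
  exact ⟨⟨isCriticallyFinite_of_isInducedBySquares isInducedBySquares_f₁,
      isCriticallyFinite_of_isInducedBySquares isInducedBySquares_f₂,
      isCriticallyFinite_of_isInducedBySquares isInducedBySquares_f₃⟩,
    ⟨isLattesExample_of_semiconj isInducedBySquares_f₁ D₁_mem cover_semiconj_D₁,
      isLattesExample_of_semiconj isInducedBySquares_f₂ D₂_mem cover_semiconj_D₂,
      isLattesExample_of_semiconj isInducedBySquares_f₃ D₃_mem cover_semiconj_D₃⟩,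
    cover, isGaloisCovering_cover, cover_semiconj_D₁, cover_semiconj_D₂, cover_semiconj_D₃⟩
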